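/- Let $n\ge 2$, $1<p<\infty$, $\beta>0$, and let $H:\mathbb R^n\to[0,\infty)$ satisfy: $H\in C^2(\mathbb R^n\setminus\{0\})$; $H(t\xi)=|t|H(\xi)$ for all $t\in\mathbb R$, $\xi\in\mathbb R^n$; every level set $\{H\le t\}$, $t>0$, is strictly convex; $a|\xi|\le H(\xi)\le b|\xi|$ for all $\xi$ and some constants $0<a\le b$; and there is $\gamma>0$ such that $$\sum_{i,j=1}^n\frac{\partial}{\partial\xi_j}\bigl(H(\eta)^{p-1}H_{\xi_i}(\eta)\bigr)\xi_i\xi_j\ \ge\ \gamma|\eta|^{p-2}|\xi|^2\qquad(\eta\ne 0,\ \xi\in\mathbb R^n).$$ Let $H^o(v)=\sup_{\xi\neq0}\frac{\xi\cdot v}{H(\xi)}$ be the polar function, and suppose that the boundary $\{H^o=1\}$ of the Wulff shape $\mathcal W=\{H^o<1\}$ has positive Gaussian curvature at every point. For a bounded Lipschitz domain $\Omega\subset\mathbb R^n$ with outer unit normal $\nu$, let $$\lambda_1(\Omega)=\inf_{u\in W^{1,p}(\Omega),\,u\ne0}\ \frac{\int_\Omega H(Du)^p\,dx+\beta\int_{\partial\Omega}|u|^pH(\nu)\,d\sigma}{\int_\Omega|u|^p\,dx},$$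 where $\sigma$ is $(n-1)$-dimensional Hausdorff measure and the values of $u$ on $\partial\Omega$ are taken in the sense of traces. (1) If $\Omega$ is a nonempty bounded convex open set with $C^2$ boundary, then $$\lambda_1(\Omega)\ \ge\ \Bigl(\frac{p-1}{p}\Bigr)^{p}\,\frac{\beta}{R_{H,\Omega}\bigl(1+\beta^{\frac1{p-1}}R_{H,\Omega}\bigr)^{p-1}},$$ where $R_{H,\Omega}=\sup_{x\in\Omega}\,\inf_{y\in\partial\Omega}H^o(x-y)$ is the anisotropic inradius of $\Omega$. (2) For every $m>0$, $\ \sup\lambda_1(\Omega)=+\infty$, the supremum being over all bounded Lipschitz domains $\Omega\subset\mathbb R^n$ with Lebesgue measure $|\Omega|=m$. -/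

import Mathlib

open MeasureTheory Filter Topology Set
open scoped RealInnerProductSpace ContDiff Gradient

noncomputable section

namespace AnisotropicRobin

/-- Euclidean space `ℝⁿ`. -/
abbrev E (n : ℕ) : Type := EuclideanSpace ℝ (Fin n)

/-- The standing assumptions on the norm `H` for the exponent `p`: regularity, absolute homogeneity,
strictly convex level sets, comparability with the Euclidean norm, and uniform ellipticity of the
derivative of `η ↦ H(η)^(p-1) ∇H(η)` away from the origin. -/
structure IsAdmissibleNorm {n : ℕ} (p : ℝ) (H : E n → ℝ) : Prop where
  contDiffOn : ContDiffOn ℝ 2 H {0}ᶜ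
  homogeneous : ∀ (t : ℝ) (ξ : E n), H (t • ξ) = |t| * H ξ
  strictConvex_level : ∀ t : ℝ, 0 < t → StrictConvex ℝ {ξ : E n | H ξ ≤ t}
  comparable : ∃ a b : ℝ, 0 < a ∧ a ≤ b ∧ ∀ ξ : E n, a * ‖ξ‖ ≤ H ξ ∧ H ξ ≤ b * ‖ξ‖
  elliptic : ∃ γ : ℝ, 0 < γ ∧ ∀ η : E n, η ≠ 0 → ∀ ξ : E n,
    γ * ‖η‖ ^ (p - 2) * ‖ξ‖ ^ 2 ≤
      ⟪fderiv ℝ (fun ζ : E n => H ζ ^ (p - 1) • ∇ H ζ) η ξ, ξ⟫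

/-- The polar function `Hᵒ(v) = sup_{ξ ≠ 0} ⟨ξ, v⟩ / H(ξ)`. -/
def polar {n : ℕ} (H : E n → ℝ) (v : E n) : ℝ :=
  ⨆ ξ : {ξ : E n // ξ ≠ 0}, ⟪(ξ : E n), v⟫ / H ξ

/-- The shape operator at `x` of a hypersurface with unit normal field `N` (defined near `x`):
the differential of the Gauss map `N`, as an endomorphism of the tangent space `N(x)^⊥`. -/
def shapeOperator {n : ℕ} (N : E n → E n) (x : E n) :
    (ℝ ∙ N x)ᗮ →ₗ[ℝ] (ℝ ∙ N x)ᗮ :=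
  ((ℝ ∙ N x)ᗮ.orthogonalProjectionOnto.comp
    ((fderiv ℝ N x).comp (ℝ ∙ N x)ᗮ.subtypeL) : (ℝ ∙ N x)ᗮ →L[ℝ] (ℝ ∙ N x)ᗮ)

/-- Gaussian curvature: the determinant of the shape operator. -/
def gaussCurvature {n : ℕ} (N : E n → E n) (x : E n) : ℝ :=
  LinearMap.det (shapeOperator N x)

/-- The unit normal field of the level sets of `f`, pointing in the direction of increase. -/
def levelNormal {n : ℕ} (f : E n → ℝ) (x : E n) : E n := ‖∇ f x‖⁻¹ • ∇ f x

/-- The boundary `{Hᵒ = 1}` of the Wulff shape has positive Gaussian curvature at every point.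
(For `n ≥ 2` a positive value forces the Gauss map to be differentiable at the point, since
otherwise the determinant above is `0`.) -/
def WulffPositivelyCurved {n : ℕ} (H : E n → ℝ) : Prop :=
  ∀ x : E n, polar H x = 1 → 0 < gaussCurvature (levelNormal (polar H)) x

/-- Inside `U`, the set `Ω` is the region below the graph of `φ` over the hyperplane `e^⊥`, in the
direction `e`. -/
def IsSubgraphIn {n : ℕ} (Ω U : Set (E n)) (e : E n) (φ : (ℝ ∙ e)ᗮ → ℝ) : Prop :=
  Ω ∩ U = {x | x ∈ U ∧ ⟪e, x⟫ < φ ((ℝ ∙ e)ᗮ.orthogonalProjectionOnto x)}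

/-- `∂Ω` is of class `C²`. -/
def HasC2Boundary {n : ℕ} (Ω : Set (E n)) : Prop :=
  ∀ x ∈ frontier Ω, ∃ U ∈ 𝓝 x, ∃ e : E n, ‖e‖ = 1 ∧
    ∃ φ : (ℝ ∙ e)ᗮ → ℝ, ContDiff ℝ 2 φ ∧ IsSubgraphIn Ω U e φ

/-- `∂Ω` is Lipschitz. -/
def HasLipschitzBoundary {n : ℕ} (Ω : Set (E n)) : Prop :=
  ∀ x ∈ frontier Ω, ∃ U ∈ 𝓝 x, ∃ e : E n, ‖e‖ = 1 ∧
    ∃ φ : (ℝ ∙ e)ᗮ → ℝ, (∃ K : NNReal, LipschitzWith K φ) ∧ IsSubgraphIn Ω U e φ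

/-- A bounded Lipschitz domain: open, connected (and nonempty), bounded, Lipschitz boundary. -/
structure IsLipschitzDomain {n : ℕ} (Ω : Set (E n)) : Prop where
  isOpen : IsOpen Ω
  isConnected : IsConnected Ω
  isBounded : Bornology.IsBounded Ω
  boundary : HasLipschitzBoundary Ω

/-- `v` is the outer unit normal to `Ω` at the boundary point `x`: to first order at `x`, the set
`Ω` is the half-space `{y | ⟨y - x, v⟩ < 0}`. Such a `v` is unique; it exists at every boundary
point if `∂Ω` is `C²`, and at almost every one if `∂Ω` is Lipschitz. -/
def IsOuterNormal {n : ℕ} (Ω : Set (E n)) (x v : E n) : Prop :=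
  ‖v‖ = 1 ∧ ∀ ε : ℝ, 0 < ε → ∃ δ : ℝ, 0 < δ ∧ ∀ y : E n, ‖y - x‖ < δ →
    (⟪y - x, v⟫ < -ε * ‖y - x‖ → y ∈ Ω) ∧ (ε * ‖y - x‖ < ⟪y - x, v⟫ → y ∉ Ω)

open Classical in
/-- The outer unit normal `ν` (with value `0` where there is none). -/
def outerNormal {n : ℕ} (Ω : Set (E n)) (x : E n) : E n :=
  if h : ∃ v, IsOuterNormal Ω x v then h.choose else 0

/-- Surface measure on `∂Ω`: the `(n-1)`-dimensional Hausdorff measure, with the usual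
normalization, for which it agrees with Lebesgue measure on hyperplanes. -/
def surfaceMeasure {n : ℕ} (Ω : Set (E n)) : Measure (E n) :=
  (Measure.euclideanHausdorffMeasure (n - 1)).restrict (frontier Ω)

/-- `G` is the weak gradient of `u` in the open set `Ω`. -/
def IsWeakGradient {n : ℕ} (Ω : Set (E n)) (u : E n → ℝ) (G : E n → E n) : Prop :=
  ∀ ψ : E n → ℝ, ContDiff ℝ ∞ ψ → HasCompactSupport ψ → tsupport ψ ⊆ Ω →
    ∫ x in Ω, u x • ∇ ψ x = -∫ x in Ω, ψ x • G x

/-- `u ∈ W^{1,p}(Ω)` with `Du = G`. -/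
structure MemW1p {n : ℕ} (p : ℝ) (Ω : Set (E n)) (u : E n → ℝ) (G : E n → E n) : Prop where
  memLp : MemLp u (ENNReal.ofReal p) (volume.restrict Ω)
  memLp_grad : MemLp G (ENNReal.ofReal p) (volume.restrict Ω)
  isWeakGradient : IsWeakGradient Ω u G

/-- `g` is the trace on `∂Ω` of the Sobolev function `u ∈ W^{1,p}(Ω)` with `Du = G`: some sequence
of smooth functions on the closure of `Ω` converges to `u` in `W^{1,p}(Ω)` while its restrictions
to `∂Ω` converge to `g` in `L^p(∂Ω)`. On a bounded Lipschitz domain this relation is the graph of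
the usual trace operator, the continuous extension of `u ↦ u|_{∂Ω}` to `W^{1,p}(Ω)`. -/
def IsTrace {n : ℕ} (p : ℝ) (Ω : Set (E n)) (u : E n → ℝ) (G : E n → E n) (g : E n → ℝ) : Prop :=
  MemLp g (ENNReal.ofReal p) (surfaceMeasure Ω) ∧
  ∃ w : ℕ → E n → ℝ, (∀ k, ContDiff ℝ ∞ (w k)) ∧
    Tendsto (fun k => eLpNorm (fun x => w k x - u x) (ENNReal.ofReal p) (volume.restrict Ω))
      atTop (𝓝 0) ∧
    Tendsto (fun k => eLpNorm (fun x => ∇ (w k) x - G x) (ENNReal.ofReal p) (volume.restrict Ω))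
      atTop (𝓝 0) ∧
    Tendsto (fun k => eLpNorm (fun x => w k x - g x) (ENNReal.ofReal p) (surfaceMeasure Ω))
      atTop (𝓝 0)

/-- The quotient `J(u)`, for a function `u` with gradient `G` in `Ω` and trace `g` on `∂Ω`. -/
def rayleigh {n : ℕ} (p β : ℝ) (H : E n → ℝ) (Ω : Set (E n))
    (u : E n → ℝ) (G : E n → E n) (g : E n → ℝ) : ℝ :=
  ((∫ x in Ω, H (G x) ^ p) + β * ∫ x, |g x| ^ p * H (outerNormal Ω x) ∂(surfaceMeasure Ω)) /
    ∫ x in Ω, |u x| ^ p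

/-- The first eigenvalue `λ₁(Ω)`: the infimum of `J(u)` over the nonzero `u ∈ W^{1,p}(Ω)`. -/
def firstEigenvalue {n : ℕ} (p β : ℝ) (H : E n → ℝ) (Ω : Set (E n)) : ℝ :=
  sInf {J : ℝ | ∃ (u : E n → ℝ) (G : E n → E n) (g : E n → ℝ),
    MemW1p p Ω u G ∧ IsTrace p Ω u G g ∧ ¬ (u =ᵐ[volume.restrict Ω] 0) ∧
      J = rayleigh p β H Ω u G g}

/-- The anisotropic distance `d_H(x) = inf_{y ∈ ∂Ω} Hᵒ(x - y)` to the boundary. -/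
def anisoDist {n : ℕ} (H : E n → ℝ) (Ω : Set (E n)) (x : E n) : ℝ :=
  ⨅ y : frontier Ω, polar H (x - y)

/-- The anisotropic inradius `R_{H,Ω} = sup_{x ∈ Ω} d_H(x)`. -/
def anisoInradius {n : ℕ} (H : E n → ℝ) (Ω : Set (E n)) : ℝ :=
  ⨆ x : Ω, anisoDist H Ω x

end AnisotropicRobin

end

/-! The lower bound holds even without the factor `((p - 1) / p) ^ p`, and it reduces to a
one-dimensional inequality. On an interval of length at most `R`, the `p`-th power integral of a
function is bounded by `lineConst` times the sum of a boundary term at one end and the energy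
(`line_estimate`). The task is to fill `Ω` with segments that end on `∂Ω` and have anisotropic
length at most the inradius.

The anisotropic distance to `∂Ω` is replaced by a minimum of finitely many affine functions, the
distances `supportDist` to supporting hyperplanes. By compactness of the closure, for any `R` above
the inradius finitely many boundary points suffice to make this minimum less than `R` everywhere.
`Ω` is cut into cells according to which hyperplane is nearest. In the cell of a hyperplane with
normal `ν`, take a vector `v` with `⟪v, ν⟫ = H ν` and `|⟪v, ξ⟫| ≤ H ξ` for all `ξ`. Along `v` the
distance to this hyperplane decreases at unit rate and no other distance decreases faster, so a ray
in direction `v` stays in its cell until it leaves `Ω`, and it does so before time `R`. The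
derivative along `v` is at most `H (∇ w)`.

Integrating over the lines parallel to `v` (`cell_estimate`) turns the end values into a boundary
integral. The projection of a piece of `∂Ω` to the orthogonal hyperplane has measure at most its
flux (`volume_projection_le_lintegral`), and the flux density of `v` is `⟪v, ν⟫ ≤ H ν` at each
boundary point. Summing over cells and letting `R` decrease to the inradius gives the inequality for
smooth functions (`smooth_estimate`); approximation extends it to Sobolev functions with their
traces (`le_rayleigh`). The `C²` boundary serves only to provide a normal at every boundary point.

For the second claim, ellipsoids of fixed volume squeezed in one direction have inradius tending to
zero, and the lower bound then tends to infinity. -/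

namespace AnisotropicRobin

open Module

/-! ### Fubini along a direction, and volumes of projections to hyperplanes -/

section Measure

variable {n : ℕ}

/-- Euclidean space as a product of a hyperplane and its normal line. -/
theorem measurePreserving_lines {e : E n} (he : ‖e‖ = 1) :
    MeasurePreserving (fun q : (ℝ ∙ e)ᗮ × ℝ => (q.1 : E n) + q.2 • e) := by
  have h1 := ((ℝ ∙ e).orthogonalDecomposition.symm.measurePreserving).comp
    (WithLp.volume_preserving_toLp (ℝ ∙ e) (ℝ ∙ e)ᗮ)
  have h2 := (LinearIsometryEquiv.toSpanUnitSingleton (𝕜 := ℝ) e he).measurePreserving.prod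
    (MeasurePreserving.id (volume : Measure (ℝ ∙ e)ᗮ))
  have h3 := (h1.comp h2).comp
    (Measure.measurePreserving_swap (μ := (volume : Measure (ℝ ∙ e)ᗮ)) (ν := (volume : Measure ℝ)))
  convert! h3 using 1
  ext1 q
  simp [Prod.map, add_comm]

theorem lintegral_lines {e : E n} (he : ‖e‖ = 1) {f : E n → ENNReal} (hf : Measurable f) :
    ∫⁻ x, f x = ∫⁻ z : (ℝ ∙ e)ᗮ, ∫⁻ s : ℝ, f ((z : E n) + s • e) := by
  rw [← (measurePreserving_lines he).lintegral_comp hf, Measure.volume_eq_prod,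
    lintegral_prod]
  exact (hf.comp (measurePreserving_lines he).measurable).aemeasurable

theorem finrank_hyperplane {e : E n} (he : ‖e‖ = 1) : finrank ℝ (ℝ ∙ e)ᗮ = n - 1 := by
  have h := (ℝ ∙ e).finrank_add_finrank_orthogonal
  rw [finrank_span_singleton (norm_ne_zero_iff.1 (by rw [he]; exact one_ne_zero)),
    finrank_euclideanSpace_fin] at h
  omega

/-- The orthogonal projection between two hyperplanes scales volumes by the cosine of the angle
of the normals. -/
theorem normDet_projection {e ν : E n} (he : ‖e‖ = 1) (hν : ‖ν‖ = 1) :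
    (((ℝ ∙ e)ᗮ.orthogonalProjectionOnto.toLinearMap).domRestrict (ℝ ∙ ν)ᗮ).normDet = |⟪ν, e⟫| := by
  set K := (ℝ ∙ e)ᗮ
  set M := (ℝ ∙ ν)ᗮ
  set f : M →ₗ[ℝ] K := (K.orthogonalProjectionOnto.toLinearMap).domRestrict M
  have hf : ∀ x : M, ((f x : K) : E n) = (x : E n) - ⟪e, (x : E n)⟫ • e := by
    intro x
    change ((K.orthogonalProjectionOnto (x : E n) : K) : E n) = _
    have h := Submodule.starProjection_orthogonal_val (K := ℝ ∙ e) (x : E n)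
    rw [Submodule.starProjection_unit_singleton ℝ he] at h
    exact h
  set a : M := M.orthogonalProjectionOnto e
  have ha : (a : E n) = e - ⟪ν, e⟫ • ν := by
    have h := Submodule.starProjection_orthogonal_val (K := ℝ ∙ ν) e
    rw [Submodule.starProjection_unit_singleton ℝ hν] at h
    exact h
  have hMν : ∀ x : M, ⟪ν, (x : E n)⟫ = 0 := fun x =>
    Submodule.mem_orthogonal_singleton_iff_inner_right.1 x.2
  have hae : ∀ x : M, ⟪a, x⟫ = ⟪e, (x : E n)⟫ := by
    intro x
    rw [Submodule.coe_inner, ha, inner_sub_left, inner_smul_left, hMν]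
    simp
  -- The Gram operator is the identity minus the rank-one operator `a ⊗ a`, so its determinant is `1
  -- - ‖a‖ ^ 2 = ⟪ν, e⟫ ^ 2`.
  have key : f.adjoint ∘ₗ f =
      LinearMap.transvection (-(innerₛₗ ℝ a) : M →ₗ[ℝ] ℝ) a := by
    ext1 x
    refine ext_inner_right ℝ fun y => ?_
    rw [LinearMap.comp_apply, LinearMap.adjoint_inner_left, Submodule.coe_inner, hf, hf,
      LinearMap.transvection.apply]
    have he' : ⟪e, e⟫ = 1 := by rw [real_inner_self_eq_norm_sq, he]; norm_num
    simp only [inner_add_left, LinearMap.neg_apply, innerₛₗ_apply_apply, hae, inner_smul_left,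
      inner_sub_left, inner_sub_right, inner_smul_right, Submodule.coe_inner, he',
      real_inner_comm e (x : E n)]
    simp
    ring
  have hsq := LinearMap.normDet_sq f
  rw [key, LinearMap.transvection.det] at hsq
  have haa : ⟪a, a⟫ = 1 - ⟪ν, e⟫ ^ 2 := by
    rw [hae, ha, inner_sub_right, real_inner_self_eq_norm_sq, he, inner_smul_right,
      real_inner_comm]
    ring
  have h2 : f.normDet ^ 2 = ⟪ν, e⟫ ^ 2 := by
    have : f.normDet ^ 2 = 1 + -⟪a, a⟫ := by simpa using hsq
    rw [this, haa]; ring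
  rw [← abs_of_nonneg f.normDet_nonneg]
  exact (sq_eq_sq_iff_abs_eq_abs _ _).1 h2

theorem volume_image_projection {e ν : E n} (he : ‖e‖ = 1) (hν : ‖ν‖ = 1) (B : Set (ℝ ∙ ν)ᗮ) :
    volume ((fun b : (ℝ ∙ ν)ᗮ => (ℝ ∙ e)ᗮ.orthogonalProjectionOnto (b : E n)) '' B) =
      ENNReal.ofReal |⟪ν, e⟫| * volume B := by
  have h := (((ℝ ∙ e)ᗮ.orthogonalProjectionOnto.toLinearMap).domRestrict
    (ℝ ∙ ν)ᗮ).euclideanHausdorffMeasure_image_eq_normDet_mul_volume B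
  rw [normDet_projection he hν] at h
  rw [← h, finrank_hyperplane hν, ← finrank_hyperplane he,
    InnerProductSpace.euclideanHausdorffMeasure_eq_volume]
  rfl

theorem euclideanHausdorffMeasure_image_le {X Y : Type*} [EMetricSpace X] [MeasurableSpace X]
    [BorelSpace X] [EMetricSpace Y] [MeasurableSpace Y] [BorelSpace Y] {C : NNReal} {f : X → Y}
    {s : Set X} (hf : LipschitzOnWith C f s) (d : ℕ) :
    Measure.euclideanHausdorffMeasure d (f '' s) ≤
      (C : ENNReal) ^ d * Measure.euclideanHausdorffMeasure d s := by
  have h := hf.hausdorffMeasure_image_le (d := d) (Nat.cast_nonneg d)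
  rw [ENNReal.rpow_natCast] at h
  simp only [Measure.euclideanHausdorffMeasure_def, Measure.smul_apply, ENNReal.smul_def, smul_eq_mul]
  rw [mul_left_comm]
  gcongr

/-- A set that is nearly orthogonal to `ν` has a projection along `e` of measure at most
about `⟨ν, e⟩` times its own. -/
theorem volume_projection_le {e ν : E n} (he : ‖e‖ = 1) (hν : ‖ν‖ = 1) (h0 : 0 < ⟪ν, e⟫)
    {η : ℝ} (hη : 1 < η) :
    ∃ δ : ℝ, 0 < δ ∧ ∀ A : Set (E n), (∀ y ∈ A, ∀ y' ∈ A, |⟪y - y', ν⟫| ≤ δ * ‖y - y'‖) →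
      volume ((ℝ ∙ e)ᗮ.orthogonalProjectionOnto '' A) ≤
        ENNReal.ofReal (η * ⟪ν, e⟫) * Measure.euclideanHausdorffMeasure (n - 1) A := by
  set c := ⟪ν, e⟫
  -- `1 + δ / c` will be the Lipschitz constant of the oblique projection `Q` on `A`; its power `n -
  -- 1` is the loss in measure.
  have hlim : ∀ᶠ δ : ℝ in 𝓝[>] 0, (1 + δ / c) ^ (n - 1) < η := by
    have : Tendsto (fun δ : ℝ => (1 + δ / c) ^ (n - 1)) (𝓝[>] 0) (𝓝 ((1 + 0 / c) ^ (n - 1))) :=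
      (by fun_prop : Continuous fun δ : ℝ => (1 + δ / c) ^ (n - 1)).continuousAt.mono_left
        nhdsWithin_le_nhds
    refine this.eventually_lt_const ?_
    simpa using hη
  obtain ⟨δ, hδ, hδ0⟩ := (hlim.and self_mem_nhdsWithin).exists
  have hδ0 : 0 < δ := hδ0
  refine ⟨δ, hδ0, fun A hA => ?_⟩
  have hmem : ∀ y : E n, y - (⟪ν, y⟫ / c) • e ∈ (ℝ ∙ ν)ᗮ := by
    intro y
    rw [Submodule.mem_orthogonal_singleton_iff_inner_right, inner_sub_right, inner_smul_right,
      div_mul_cancel₀ _ h0.ne', sub_self]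
  -- Projecting to `ν^⊥` along `e` first does not change the image in `e^⊥`, and it replaces `A` by
  -- a flat set whose projection is computed exactly.
  let Q : E n → (ℝ ∙ ν)ᗮ := fun y => ⟨y - (⟪ν, y⟫ / c) • e, hmem y⟩
  have hC : 0 ≤ 1 + δ / c := by positivity
  have hQ : LipschitzOnWith ⟨1 + δ / c, hC⟩ Q A := by
    refine LipschitzOnWith.of_dist_le_mul fun y hy y' hy' => ?_
    rw [Subtype.dist_eq, dist_eq_norm, dist_eq_norm]
    have : y - (⟪ν, y⟫ / c) • e - (y' - (⟪ν, y'⟫ / c) • e) =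
        (y - y') - (⟪y - y', ν⟫ / c) • e := by
      rw [inner_sub_left, real_inner_comm y ν, real_inner_comm y' ν]
      module
    change ‖y - (⟪ν, y⟫ / c) • e - (y' - (⟪ν, y'⟫ / c) • e)‖ ≤ (1 + δ / c) * ‖y - y'‖
    rw [this]
    calc _ ≤ ‖y - y'‖ + ‖(⟪y - y', ν⟫ / c) • e‖ := norm_sub_le _ _
      _ = ‖y - y'‖ + |⟪y - y', ν⟫| / c := by
        rw [norm_smul, he, mul_one, Real.norm_eq_abs, abs_div, abs_of_pos h0]
      _ ≤ ‖y - y'‖ + δ * ‖y - y'‖ / c := by gcongr; exact hA y hy y' hy'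
      _ = _ := by ring
  have himage : (ℝ ∙ e)ᗮ.orthogonalProjectionOnto '' A =
      (fun b : (ℝ ∙ ν)ᗮ => (ℝ ∙ e)ᗮ.orthogonalProjectionOnto (b : E n)) '' (Q '' A) := by
    rw [image_image]
    refine image_congr fun y _ => ?_
    have h1 : (ℝ ∙ e)ᗮ.orthogonalProjectionOnto e = 0 :=
      Submodule.orthogonalProjectionOnto_orthogonal_apply_eq_zero
        (Submodule.mem_span_singleton_self e)
    change _ = (ℝ ∙ e)ᗮ.orthogonalProjectionOnto (y - (⟪ν, y⟫ / c) • e)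
    rw [map_sub, map_smul, h1, smul_zero, sub_zero]
  rw [himage, volume_image_projection he hν, abs_of_pos h0]
  calc ENNReal.ofReal c * volume (Q '' A)
      = ENNReal.ofReal c * Measure.euclideanHausdorffMeasure (n - 1) (Q '' A) := by
        rw [← InnerProductSpace.euclideanHausdorffMeasure_eq_volume, finrank_hyperplane hν]
    _ ≤ ENNReal.ofReal c * (ENNReal.ofReal (1 + δ / c) ^ (n - 1) *
          Measure.euclideanHausdorffMeasure (n - 1) A) := by
        gcongr
        refine (euclideanHausdorffMeasure_image_le hQ (n - 1)).trans_eq ?_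
        rw [ENNReal.ofReal_eq_coe_nnreal hC]
        rfl
    _ ≤ ENNReal.ofReal c * (ENNReal.ofReal η * Measure.euclideanHausdorffMeasure (n - 1) A) := by
        gcongr
        rw [← ENNReal.ofReal_pow hC]
        exact ENNReal.ofReal_le_ofReal hδ.le
    _ = _ := by rw [← mul_assoc, mul_comm η, ENNReal.ofReal_mul h0.le]

end Measure

/-! ### Outer normals: existence, support property of convex sets, continuity -/

section Normal

variable {n : ℕ} {Ω : Set (E n)}

theorem inner_projection_add {e : E n} (x : E n) (he : ‖e‖ = 1) :
    (((ℝ ∙ e)ᗮ.orthogonalProjectionOnto x : (ℝ ∙ e)ᗮ) : E n) + ⟪e, x⟫ • e = x := by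
  have h := Submodule.starProjection_orthogonal_val (K := ℝ ∙ e) x
  rw [Submodule.starProjection_unit_singleton ℝ he] at h
  change (((ℝ ∙ e)ᗮ.orthogonalProjectionOnto x : (ℝ ∙ e)ᗮ) : E n) = x - ⟪e, x⟫ • e at h
  rw [h, sub_add_cancel]

theorem inner_hyperplane {e : E n} (z : (ℝ ∙ e)ᗮ) : ⟪e, (z : E n)⟫ = 0 :=
  Submodule.mem_orthogonal_singleton_iff_inner_right.1 z.2

theorem projection_add_smul {e : E n} (z : (ℝ ∙ e)ᗮ) (s : ℝ) :
    (ℝ ∙ e)ᗮ.orthogonalProjectionOnto ((z : E n) + s • e) = z := by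
  rw [map_add, map_smul, Submodule.orthogonalProjectionOnto_orthogonal_apply_eq_zero
    (Submodule.mem_span_singleton_self e), smul_zero, add_zero,
    Submodule.orthogonalProjectionOnto_mem_subspace_eq_self]

theorem inner_add_smul {e : E n} (he : ‖e‖ = 1) (z : (ℝ ∙ e)ᗮ) (s : ℝ) :
    ⟪e, (z : E n) + s • e⟫ = s := by
  rw [inner_add_right, inner_hyperplane, inner_smul_right, real_inner_self_eq_norm_sq, he]
  ring

/-- On the boundary of a subgraph the defining inequality is an equality. -/
theorem IsSubgraphIn.eq_of_mem_frontier (hΩ : IsOpen Ω) {U : Set (E n)} {e x : E n}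
    {φ : (ℝ ∙ e)ᗮ → ℝ} (hφ : Continuous φ) (h : IsSubgraphIn Ω U e φ) (hx : x ∈ frontier Ω)
    (hU : U ∈ 𝓝 x) : ⟪e, x⟫ = φ ((ℝ ∙ e)ᗮ.orthogonalProjectionOnto x) := by
  apply le_antisymm
  · by_contra! hlt
    have hopen : ∀ᶠ y in 𝓝 x, φ ((ℝ ∙ e)ᗮ.orthogonalProjectionOnto y) < ⟪e, y⟫ :=
      (hφ.comp (ℝ ∙ e)ᗮ.orthogonalProjectionOnto.continuous).continuousAt.eventually_lt
        (by fun_prop : Continuous fun y : E n => ⟪e, y⟫).continuousAt hlt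
    obtain ⟨y, ⟨hy, hyU⟩, hyΩ⟩ := mem_closure_iff_nhds.1 (frontier_subset_closure hx) _
      (hopen.and hU)
    have : y ∈ Ω ∩ U := ⟨hyΩ, hyU⟩
    rw [h] at this
    exact lt_asymm hy this.2
  · by_contra! hlt
    have : x ∈ Ω ∩ U := by rw [h]; exact ⟨mem_of_mem_nhds hU, hlt⟩
    rw [hΩ.frontier_eq] at hx
    exact hx.2 this.1

/-- A region below the graph of a differentiable function has a normal. -/
theorem IsSubgraphIn.exists_isOuterNormal (hΩ : IsOpen Ω) {U : Set (E n)} {e x : E n}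
    (he : ‖e‖ = 1) {φ : (ℝ ∙ e)ᗮ → ℝ} (hφ : Continuous φ)
    (hd : DifferentiableAt ℝ φ ((ℝ ∙ e)ᗮ.orthogonalProjectionOnto x))
    (h : IsSubgraphIn Ω U e φ) (hx : x ∈ frontier Ω) (hU : U ∈ 𝓝 x) :
    ∃ v, IsOuterNormal Ω x v := by
  have hx0 := h.eq_of_mem_frontier hΩ hφ hx hU
  set P := (ℝ ∙ e)ᗮ.orthogonalProjectionOnto
  set f : E n → ℝ := fun y => ⟪e, y⟫ - φ (P y)
  have hf : HasGradientAt f (∇ f x) x := by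
    apply DifferentiableAt.hasGradientAt
    refine DifferentiableAt.sub (innerSL ℝ e).differentiableAt ?_
    exact hd.comp x P.differentiableAt
  set w := ∇ f x
  -- The defining function `f` grows at rate exactly `1` in direction `e`, so its gradient cannot
  -- vanish.
  have hw : w ≠ 0 := by
    intro hw0
    have h1 : HasFDerivAt f (0 : E n →L[ℝ] ℝ) x := by
      have := hf.hasFDerivAt; rwa [hw0, map_zero] at this
    have h2 : HasDerivAt (fun t : ℝ => f (x + t • e)) ((0 : E n →L[ℝ] ℝ) e) 0 := by
      have h3 : HasDerivAt (fun t : ℝ => x + t • e) e 0 := by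
        simpa using ((hasDerivAt_id (0 : ℝ)).smul_const e).const_add x
      exact HasFDerivAt.comp_hasDerivAt (0 : ℝ) (by simpa using h1) h3
    have h4 : (fun t : ℝ => f (x + t • e)) = fun t => f x + t := by
      ext t
      have h5 : P (x + t • e) = P x := by
        rw [map_add, map_smul, Submodule.orthogonalProjectionOnto_orthogonal_apply_eq_zero
          (Submodule.mem_span_singleton_self e), smul_zero, add_zero]
      simp only [f, h5, inner_add_right, inner_smul_right, real_inner_self_eq_norm_sq, he]
      ring
    rw [h4] at h2
    have := h2.unique ((hasDerivAt_id (0 : ℝ)).const_add (f x))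
    simp at this
  have hw0 : 0 < ‖w‖ := norm_pos_iff.2 hw
  have hfx : f x = 0 := by simp [f, hx0]
  refine ⟨‖w‖⁻¹ • w, ?_, fun ε hε => ?_⟩
  · rw [norm_smul, norm_inv, norm_norm, inv_mul_cancel₀ hw0.ne']
  have hsmall := (hasGradientAt_iff_isLittleO.1 hf).def (mul_pos hε hw0)
  obtain ⟨δ, hδ, hball⟩ := Metric.mem_nhds_iff.1 (inter_mem hsmall hU)
  refine ⟨δ, hδ, fun y hy => ?_⟩
  obtain ⟨hy1, hyU⟩ := hball (show y ∈ Metric.ball x δ by rwa [Metric.mem_ball, dist_eq_norm])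
  have hy1 : ‖f y - f x - ⟪w, y - x⟫‖ ≤ ε * ‖w‖ * ‖y - x‖ := hy1
  rw [hfx, sub_zero, Real.norm_eq_abs, abs_le] at hy1
  have hmem : y ∈ Ω ↔ f y < 0 := by
    constructor
    · intro hyΩ
      have : y ∈ Ω ∩ U := ⟨hyΩ, hyU⟩
      rw [h] at this
      exact sub_neg.2 this.2
    · intro hfy
      have : y ∈ Ω ∩ U := by rw [h]; exact ⟨hyU, sub_neg.1 hfy⟩
      exact this.1
  have hin : ⟪y - x, ‖w‖⁻¹ • w⟫ * ‖w‖ = ⟪w, y - x⟫ := by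
    rw [inner_smul_right, real_inner_comm]; field_simp
  rw [hmem]
  constructor
  · intro hlt
    have := mul_lt_mul_of_pos_right hlt hw0
    rw [hin] at this
    nlinarith [hy1.2]
  · intro hlt
    have := mul_lt_mul_of_pos_right hlt hw0
    rw [hin] at this
    rw [not_lt]
    nlinarith [hy1.1]

theorem HasC2Boundary.exists_isOuterNormal (h : HasC2Boundary Ω) (hΩ : IsOpen Ω) :
    ∀ x ∈ frontier Ω, ∃ v, IsOuterNormal Ω x v := by
  intro x hx
  obtain ⟨U, hU, e, he, φ, hφ, hsub⟩ := h x hx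
  exact hsub.exists_isOuterNormal hΩ he hφ.continuous
    (hφ.differentiable (by norm_num)).differentiableAt hx hU

theorem isOuterNormal_outerNormal {x : E n} (h : ∃ v, IsOuterNormal Ω x v) :
    IsOuterNormal Ω x (outerNormal Ω x) := by
  rw [outerNormal, dif_pos h]
  exact h.choose_spec

/-- If the product were positive, the segment from `x` to `z` would lie in `Ω` by convexity, yet
leave it to first order at `x`. Strictness follows because `Ω` is open and `z` can be pushed along
`v`. -/
theorem IsOuterNormal.inner_neg (hΩ : IsOpen Ω) (hc : Convex ℝ Ω) {x v z : E n}
    (hv : IsOuterNormal Ω x v) (hx : x ∈ frontier Ω) (hz : z ∈ Ω) : ⟪z - x, v⟫ < 0 := by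
  have hle : ∀ z ∈ Ω, ⟪z - x, v⟫ ≤ 0 := by
    intro z hz
    by_contra! hpos
    have hzx : z - x ≠ 0 := by rintro h; simp [h] at hpos
    have hn := norm_pos_iff.2 hzx
    obtain ⟨δ, hδ, H⟩ := hv.2 (⟪z - x, v⟫ / ‖z - x‖ / 2) (by positivity)
    set t := min 1 (δ / ‖z - x‖ / 2)
    have ht0 : 0 < t := by positivity
    have hsub : x + t • (z - x) - x = t • (z - x) := by abel
    have hmem : x + t • (z - x) ∈ Ω := by
      have := hc.add_smul_sub_mem_interior' (frontier_subset_closure hx)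
        (by rwa [hΩ.interior_eq]) ⟨ht0, min_le_left _ _⟩
      rwa [hΩ.interior_eq] at this
    refine (H (x + t • (z - x)) ?_).2 ?_ hmem
    · rw [hsub, norm_smul, Real.norm_eq_abs, abs_of_pos ht0]
      calc t * ‖z - x‖ ≤ δ / ‖z - x‖ / 2 * ‖z - x‖ := by gcongr; exact min_le_right _ _
        _ = δ / 2 := by field_simp
        _ < δ := by linarith
    · rw [hsub, norm_smul, Real.norm_eq_abs, abs_of_pos ht0, real_inner_smul_left]
      calc _ = t * ⟪z - x, v⟫ / 2 := by field_simp
        _ < _ := by nlinarith [mul_pos ht0 hpos]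
  have hcont : Tendsto (fun t : ℝ => z + t • v) (𝓝[>] 0) (𝓝 z) := by
    have : Continuous fun t : ℝ => z + t • v := by fun_prop
    simpa using (this.tendsto 0).mono_left nhdsWithin_le_nhds
  obtain ⟨t, ht, ht0⟩ := ((hcont.eventually (hΩ.mem_nhds hz)).and self_mem_nhdsWithin).exists
  have ht0 : 0 < t := ht0
  have := hle _ ht
  rw [add_sub_right_comm, inner_add_left, real_inner_smul_left, real_inner_self_eq_norm_sq,
    hv.1] at this
  linarith

theorem IsOuterNormal.inner_nonpos (hΩ : IsOpen Ω) (hc : Convex ℝ Ω) {x v z : E n}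
    (hv : IsOuterNormal Ω x v) (hx : x ∈ frontier Ω) (hz : z ∈ closure Ω) : ⟪z - x, v⟫ ≤ 0 := by
  have hcl : IsClosed {z : E n | ⟪z - x, v⟫ ≤ 0} :=
    isClosed_le (by fun_prop) continuous_const
  exact closure_minimal (fun z hz => (hv.inner_neg hΩ hc hx hz).le) hcl hz

/-- If `u ≠ v`, then `u - v` points strictly inward with respect to `v`, so a short step along it
enters `Ω`; but the same step increases the product with `u`. -/
theorem IsOuterNormal.eq_of_forall_inner_nonpos {x v u : E n}
    (hv : IsOuterNormal Ω x v) (hu : ‖u‖ = 1) (h : ∀ z ∈ Ω, ⟪z - x, u⟫ ≤ 0) : u = v := by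
  by_contra hne
  have hw : 0 < ‖u - v‖ := norm_pos_iff.2 (sub_ne_zero.2 hne)
  have hsq : ‖u - v‖ ^ 2 = 2 * (1 - ⟪u, v⟫) := by
    rw [@norm_sub_sq_real, hu, hv.1]; ring
  have huv : 0 < 1 - ⟪u, v⟫ := by nlinarith [pow_pos hw 2]
  have h1 : ⟪u - v, v⟫ = -(1 - ⟪u, v⟫) := by
    rw [inner_sub_left, real_inner_self_eq_norm_sq, hv.1]; ring
  have h2 : ⟪u - v, u⟫ = 1 - ⟪u, v⟫ := by
    rw [inner_sub_left, real_inner_self_eq_norm_sq, hu, real_inner_comm]; ring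
  obtain ⟨δ, hδ, H⟩ := hv.2 ((1 - ⟪u, v⟫) / ‖u - v‖ / 2) (by positivity)
  set t := δ / ‖u - v‖ / 2
  have ht0 : 0 < t := by positivity
  have hsub : x + t • (u - v) - x = t • (u - v) := by abel
  have hmem : x + t • (u - v) ∈ Ω := by
    refine (H _ ?_).1 ?_
    · rw [hsub, norm_smul, Real.norm_eq_abs, abs_of_pos ht0]
      calc t * ‖u - v‖ = δ / 2 := by simp only [t]; field_simp
        _ < δ := by linarith
    · rw [hsub, norm_smul, Real.norm_eq_abs, abs_of_pos ht0, real_inner_smul_left, h1]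
      have : -((1 - ⟪u, v⟫) / ‖u - v‖ / 2) * (t * ‖u - v‖) = -(t * (1 - ⟪u, v⟫)) / 2 := by
        field_simp
      rw [this]
      nlinarith [mul_pos ht0 huv]
  have := h _ hmem
  rw [hsub, real_inner_smul_left, h2] at this
  nlinarith [mul_pos ht0 huv]

/-- Normals lie in the compact unit sphere, a limit of supporting directions is again supporting,
and the supporting unit vector at `x` is unique. -/
theorem continuousOn_outerNormal (hΩ : IsOpen Ω) (hc : Convex ℝ Ω)
    (hN : ∀ x ∈ frontier Ω, ∃ v, IsOuterNormal Ω x v) :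
    ContinuousOn (outerNormal Ω) (frontier Ω) := by
  intro x hx
  refine (isCompact_sphere (0 : E n) 1).tendsto_nhds_of_unique_mapClusterPt ?_ ?_
  · filter_upwards [self_mem_nhdsWithin] with y hy
    simpa using (isOuterNormal_outerNormal (hN y hy)).1
  · intro u hu hcl
    obtain ⟨V, hV, hVu⟩ := mapClusterPt_iff_ultrafilter.1 hcl
    refine (isOuterNormal_outerNormal (hN x hx)).eq_of_forall_inner_nonpos (by simpa using hu) ?_
    intro z hz
    have hid : Tendsto (fun y : E n => z - y) V (𝓝 (z - x)) :=
      ((continuous_const.sub continuous_id).tendsto x).mono_left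
        (hV.trans nhdsWithin_le_nhds)
    refine le_of_tendsto (hid.inner hVu) ?_
    filter_upwards [hV self_mem_nhdsWithin] with y hy
    exact ((isOuterNormal_outerNormal (hN y hy)).inner_neg hΩ hc hy hz).le

end Normal

/-! ### Projected boundary measure and flux -/

section Surface

variable {n : ℕ} {Ω : Set (E n)}

theorem measurableSet_frontier_inner_pos (hΩ : IsOpen Ω) (hc : Convex ℝ Ω)
    (hN : ∀ x ∈ frontier Ω, ∃ v, IsOuterNormal Ω x v) (e : E n) :
    MeasurableSet {y | y ∈ frontier Ω ∧ 0 < ⟪outerNormal Ω y, e⟫} := by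
  have hcont : ContinuousOn (fun y => ⟪outerNormal Ω y, e⟫) (frontier Ω) :=
    (continuousOn_outerNormal hΩ hc hN).inner continuousOn_const
  obtain ⟨u, hu, h⟩ := continuousOn_iff'.1 hcont (Ioi 0) isOpen_Ioi
  have : {y | y ∈ frontier Ω ∧ 0 < ⟪outerNormal Ω y, e⟫} = u ∩ frontier Ω := by
    rw [← h]; ext y; simp [and_comm]
  rw [this]
  exact hu.measurableSet.inter isClosed_frontier.measurableSet

/-- Local form of `volume_projection_le_lintegral`. -/
theorem exists_nhds_volume_projection_le (hΩ : IsOpen Ω) (hc : Convex ℝ Ω)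
    (hN : ∀ x ∈ frontier Ω, ∃ v, IsOuterNormal Ω x v) {e : E n} (he : ‖e‖ = 1) {η : ℝ}
    (hη : 1 < η) {y₀ : E n} (hy₀ : y₀ ∈ frontier Ω) (hpos : 0 < ⟪outerNormal Ω y₀, e⟫) :
    ∃ N : Set (E n), IsOpen N ∧ y₀ ∈ N ∧ ∀ A : Set (E n), MeasurableSet A → A ⊆ frontier Ω →
      A ⊆ N → volume ((ℝ ∙ e)ᗮ.orthogonalProjectionOnto '' A) ≤ ENNReal.ofReal (η ^ 2) *
        ∫⁻ y in A, ENNReal.ofReal ⟪outerNormal Ω y, e⟫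
          ∂(Measure.euclideanHausdorffMeasure (n - 1)) := by
  set ν₀ := outerNormal Ω y₀
  have hν := fun y hy => isOuterNormal_outerNormal (hN y hy)
  obtain ⟨δ, hδ, hvol⟩ := volume_projection_le he (hν y₀ hy₀).1 hpos hη
  have hcont := continuousOn_outerNormal hΩ hc hN y₀ hy₀
  have h1 : ∀ᶠ y in 𝓝[frontier Ω] y₀, ‖outerNormal Ω y - ν₀‖ < δ := by
    have : Tendsto (fun y => ‖outerNormal Ω y - ν₀‖) (𝓝[frontier Ω] y₀) (𝓝 ‖ν₀ - ν₀‖) :=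
      (hcont.sub tendsto_const_nhds).norm
    rw [sub_self, norm_zero] at this
    exact this.eventually_lt_const hδ
  have h2 : ∀ᶠ y in 𝓝[frontier Ω] y₀, ⟪ν₀, e⟫ / η < ⟪outerNormal Ω y, e⟫ := by
    have : Tendsto (fun y => ⟪outerNormal Ω y, e⟫) (𝓝[frontier Ω] y₀) (𝓝 ⟪ν₀, e⟫) :=
      hcont.inner tendsto_const_nhds
    exact this.eventually_const_lt (div_lt_self hpos hη)
  obtain ⟨N, hNo, hyN, hNsub⟩ := mem_nhdsWithin.1 (h1.and h2)
  refine ⟨N, hNo, hyN, fun A hA hAf hAN => ?_⟩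
  -- The hyperplane at `y'` supports `Ω`, and replacing its normal by `ν₀` costs at most `δ * ‖y -
  -- y'‖`. Exchanging `y` and `y'` gives the two-sided bound.
  have hin : ∀ y ∈ A, ∀ y' ∈ A, ⟪y - y', ν₀⟫ ≤ δ * ‖y - y'‖ := by
    intro y hy y' hy'
    have h3 := (hν y' (hAf hy')).inner_nonpos hΩ hc (hAf hy')
      (frontier_subset_closure (hAf hy))
    have h4 : ⟪y - y', ν₀⟫ = ⟪y - y', outerNormal Ω y'⟫ - ⟪y - y', outerNormal Ω y' - ν₀⟫ := by
      rw [inner_sub_right]; ring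
    have h5 := neg_le_of_abs_le (abs_real_inner_le_norm (y - y') (outerNormal Ω y' - ν₀))
    have h6 : ‖y - y'‖ * ‖outerNormal Ω y' - ν₀‖ ≤ ‖y - y'‖ * δ := by
      gcongr
      exact (hNsub ⟨hAN hy', hAf hy'⟩).1.le
    linarith
  refine (hvol A fun y hy y' hy' => abs_le.2 ⟨?_, hin y hy y' hy'⟩).trans ?_
  · have := hin y' hy' y hy
    rw [← neg_sub y y', inner_neg_left, norm_neg] at this
    linarith
  · rw [← setLIntegral_const, ← lintegral_const_mul' _ _ ENNReal.ofReal_ne_top]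
    refine setLIntegral_mono' hA fun y hy => ?_
    rw [← ENNReal.ofReal_mul (by positivity)]
    apply ENNReal.ofReal_le_ofReal
    have h7 := (hNsub ⟨hAN hy, hAf hy⟩).2
    have h7 : ⟪ν₀, e⟫ / η < ⟪outerNormal Ω y, e⟫ := h7
    rw [div_lt_iff₀ (by linarith)] at h7
    nlinarith

/-- The projection of a piece of the boundary along `e` has measure at most the flux of `e`. -/
theorem volume_projection_le_lintegral (hΩ : IsOpen Ω) (hc : Convex ℝ Ω)
    (hN : ∀ x ∈ frontier Ω, ∃ v, IsOuterNormal Ω x v) {e : E n} (he : ‖e‖ = 1) {A : Set (E n)}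
    (hA : MeasurableSet A) (hAf : A ⊆ {y | y ∈ frontier Ω ∧ 0 < ⟪outerNormal Ω y, e⟫}) :
    volume ((ℝ ∙ e)ᗮ.orthogonalProjectionOnto '' A) ≤
      ∫⁻ y in A, ENNReal.ofReal ⟪outerNormal Ω y, e⟫
        ∂(Measure.euclideanHausdorffMeasure (n - 1)) := by
  set I := ∫⁻ y in A, ENNReal.ofReal ⟪outerNormal Ω y, e⟫
    ∂(Measure.euclideanHausdorffMeasure (n - 1))
  have key : ∀ η : ℝ, 1 < η → volume ((ℝ ∙ e)ᗮ.orthogonalProjectionOnto '' A) ≤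
      ENNReal.ofReal (η ^ 2) * I := by
    intro η hη
    -- By the Lindelöf property countably many nearly flat neighbourhoods cover `A`; made disjoint,
    -- their fluxes add up to the flux through `A`. The factor `η ^ 2` disappears at the end as `η`
    -- tends to `1`.
    choose! N hNo hyN hvol using fun (y : E n) (hy : y ∈ A) =>
      exists_nhds_volume_projection_le hΩ hc hN he hη (hAf hy).1 (hAf hy).2
    obtain ⟨t, htA, htc, hcov⟩ := TopologicalSpace.countable_cover_nhdsWithin
      (s := A) (f := N) fun y hy => mem_nhdsWithin_of_mem_nhds ((hNo y hy).mem_nhds (hyN y hy))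
    rcases A.eq_empty_or_nonempty with rfl | hAne
    · simp
    have htne : t.Nonempty := by
      rw [nonempty_iff_ne_empty]; rintro rfl
      obtain ⟨a, ha⟩ := hAne
      simpa using hcov ha
    obtain ⟨g, rfl⟩ := htc.exists_eq_range htne
    set D : ℕ → Set (E n) := fun k => A ∩ disjointed (fun k => N (g k)) k
    have hNm : ∀ k, MeasurableSet (N (g k)) :=
      fun k => (hNo _ (htA (mem_range_self k))).measurableSet
    have hD : ∀ k, MeasurableSet (D k) :=
      fun k => hA.inter (MeasurableSet.disjointed hNm k)
    have hAD : A = ⋃ k, D k := by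
      rw [← inter_iUnion, iUnion_disjointed, left_eq_inter]
      simpa using hcov
    have hdisj : Pairwise (Function.onFun Disjoint D) := fun i j hij =>
      (disjoint_disjointed _ hij).mono inter_subset_right inter_subset_right
    calc volume ((ℝ ∙ e)ᗮ.orthogonalProjectionOnto '' A)
        = volume (⋃ k, (ℝ ∙ e)ᗮ.orthogonalProjectionOnto '' D k) := by
          rw [← image_iUnion, ← hAD]
      _ ≤ ∑' k, volume ((ℝ ∙ e)ᗮ.orthogonalProjectionOnto '' D k) := measure_iUnion_le _
      _ ≤ ∑' k, ENNReal.ofReal (η ^ 2) * ∫⁻ y in D k, ENNReal.ofReal ⟪outerNormal Ω y, e⟫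
            ∂(Measure.euclideanHausdorffMeasure (n - 1)) := by
          refine ENNReal.tsum_le_tsum fun k => ?_
          exact hvol (g k) (htA (mem_range_self k)) _ (hD k)
            (fun y hy => (hAf hy.1).1) (fun y hy => disjointed_subset (fun k => N (g k)) k hy.2)
      _ = ENNReal.ofReal (η ^ 2) * I := by
          rw [ENNReal.tsum_mul_left, ← lintegral_iUnion hD hdisj, ← hAD]
  have hlim : Tendsto (fun η : ℝ => ENNReal.ofReal (η ^ 2) * I) (𝓝[>] 1) (𝓝 (1 * I)) := by
    refine ENNReal.Tendsto.mul_const ?_ (Or.inl one_ne_zero)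
    have : Continuous fun η : ℝ => ENNReal.ofReal (η ^ 2) :=
      ENNReal.continuous_ofReal.comp (continuous_pow 2)
    simpa using (this.tendsto 1).mono_left nhdsWithin_le_nhds
  rw [one_mul] at hlim
  exact ge_of_tendsto hlim (eventually_mem_nhdsWithin.mono fun η hη => key η hη)

/-- The height of `Ω` over the point `z` of the hyperplane `e^⊥`. -/
noncomputable def upperHeight (Ω : Set (E n)) (e : E n) (z : (ℝ ∙ e)ᗮ) : ℝ :=
  sSup {s : ℝ | (z : E n) + s • e ∈ Ω}

/-- The point where the line over `z` in direction `e` leaves `Ω`. -/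
noncomputable def exitPoint (Ω : Set (E n)) (e : E n) (z : (ℝ ∙ e)ᗮ) : E n :=
  (z : E n) + upperHeight Ω e z • e

/-- The projection of `Ω` to the hyperplane `e^⊥`. -/
def shadow (Ω : Set (E n)) (e : E n) : Set (ℝ ∙ e)ᗮ :=
  {z | ∃ s : ℝ, (z : E n) + s • e ∈ Ω}

variable {e : E n}

theorem bddAbove_line (hb : Bornology.IsBounded Ω) (he : ‖e‖ = 1) (z : (ℝ ∙ e)ᗮ) :
    BddAbove {s : ℝ | (z : E n) + s • e ∈ Ω} := by
  obtain ⟨C, hC⟩ := hb.exists_norm_le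
  refine ⟨C, fun s hs => ?_⟩
  calc s = ⟪e, (z : E n) + s • e⟫ := (inner_add_smul he z s).symm
    _ ≤ ‖e‖ * ‖(z : E n) + s • e‖ := real_inner_le_norm _ _
    _ ≤ C := by rw [he, one_mul]; exact hC _ hs

theorem continuous_line (z : E n) (e : E n) : Continuous fun s : ℝ => z + s • e := by fun_prop

theorem lt_upperHeight (hΩ : IsOpen Ω) (hb : Bornology.IsBounded Ω) (he : ‖e‖ = 1)
    {z : (ℝ ∙ e)ᗮ} {s : ℝ} (hs : (z : E n) + s • e ∈ Ω) : s < upperHeight Ω e z := by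
  have hev : ∀ᶠ t in 𝓝[>] s, (z : E n) + t • e ∈ Ω :=
    nhdsWithin_le_nhds ((continuous_line (z : E n) e).continuousAt.preimage_mem_nhds
      (hΩ.mem_nhds hs))
  obtain ⟨t, ht, hst⟩ := (hev.and self_mem_nhdsWithin).exists
  exact lt_of_lt_of_le hst (le_csSup (bddAbove_line hb he z) ht)

theorem line_mem_of_lt_upperHeight (hc : Convex ℝ Ω) {z : (ℝ ∙ e)ᗮ} {s t : ℝ}
    (hs : (z : E n) + s • e ∈ Ω) (hst : s ≤ t) (ht : t < upperHeight Ω e z) :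
    (z : E n) + t • e ∈ Ω := by
  obtain ⟨r, hr, htr⟩ := exists_lt_of_lt_csSup ⟨s, hs⟩ ht
  have hconv : OrdConnected {s : ℝ | (z : E n) + s • e ∈ Ω} := by
    have h := (hc.affine_preimage (AffineMap.lineMap (k := ℝ) (z : E n) ((z : E n) + e))).ordConnected
    have heq : (AffineMap.lineMap (k := ℝ) (z : E n) ((z : E n) + e)) ⁻¹' Ω =
        {s : ℝ | (z : E n) + s • e ∈ Ω} := by
      ext s
      simp [AffineMap.lineMap_apply, add_comm]
    rwa [heq] at h
  exact hconv.out hs hr ⟨hst, htr.le⟩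

theorem exitPoint_mem_frontier (hΩ : IsOpen Ω) (hb : Bornology.IsBounded Ω) (he : ‖e‖ = 1)
    {z : (ℝ ∙ e)ᗮ} (hz : z ∈ shadow Ω e) : exitPoint Ω e z ∈ frontier Ω := by
  rw [hΩ.frontier_eq]
  refine ⟨?_, fun h => lt_irrefl _ (lt_upperHeight hΩ hb he h)⟩
  exact map_mem_closure (f := fun s : ℝ => (z : E n) + s • e) (continuous_line (z : E n) e)
    (csSup_mem_closure hz (bddAbove_line hb he z)) fun s hs => hs

/-- An interior point of the line lies strictly behind the supporting hyperplane at the exit point,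
and moving from it along `e` reaches that hyperplane. -/
theorem inner_outerNormal_exitPoint_pos (hΩ : IsOpen Ω) (hc : Convex ℝ Ω)
    (hb : Bornology.IsBounded Ω) (hN : ∀ x ∈ frontier Ω, ∃ v, IsOuterNormal Ω x v)
    (he : ‖e‖ = 1) {z : (ℝ ∙ e)ᗮ} (hz : z ∈ shadow Ω e) :
    0 < ⟪outerNormal Ω (exitPoint Ω e z), e⟫ := by
  have hf := exitPoint_mem_frontier hΩ hb he hz
  obtain ⟨s, hs⟩ := hz
  have h := (isOuterNormal_outerNormal (hN _ hf)).inner_neg hΩ hc hf hs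
  have hlt := lt_upperHeight hΩ hb he hs
  have : (z : E n) + s • e - exitPoint Ω e z = -((upperHeight Ω e z - s) • e) := by
    rw [exitPoint]; module
  rw [this, inner_neg_left, real_inner_smul_left, real_inner_comm] at h
  by_contra! hle
  nlinarith

theorem isOpen_shadow_above (hΩ : IsOpen Ω) (S : Set ℝ) :
    IsOpen {z : (ℝ ∙ e)ᗮ | ∃ s ∈ S, (z : E n) + s • e ∈ Ω} := by
  have : {z : (ℝ ∙ e)ᗮ | ∃ s ∈ S, (z : E n) + s • e ∈ Ω} =
      ⋃ s ∈ S, (fun z : (ℝ ∙ e)ᗮ => (z : E n) + s • e) ⁻¹' Ω := by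
    ext z; simp
  rw [this]
  exact isOpen_biUnion fun s _ => hΩ.preimage (by fun_prop)

theorem isOpen_shadow (hΩ : IsOpen Ω) : IsOpen (shadow Ω e) := by
  simpa [shadow] using isOpen_shadow_above (e := e) hΩ univ

theorem measurable_upperHeight (hΩ : IsOpen Ω) (hb : Bornology.IsBounded Ω) (he : ‖e‖ = 1) :
    Measurable (upperHeight Ω e) := by
  refine measurable_of_Ioi fun r => ?_
  -- Off the shadow the height has the default value `sSup ∅ = 0`, which exceeds `r` exactly when `r
  -- < 0`.
  have : upperHeight Ω e ⁻¹' Ioi r =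
      {z : (ℝ ∙ e)ᗮ | ∃ s ∈ Ioi r, (z : E n) + s • e ∈ Ω} ∪
        ((shadow Ω e)ᶜ ∩ {_z | r < 0}) := by
    ext z
    simp only [mem_preimage, mem_Ioi, mem_union, mem_ofPred_eq, mem_inter_iff, mem_compl_iff]
    by_cases hz : z ∈ shadow Ω e
    · constructor
      · intro h
        obtain ⟨s, hs, hrs⟩ := exists_lt_of_lt_csSup hz h
        exact Or.inl ⟨s, hrs, hs⟩
      · rintro (⟨s, hrs, hs⟩ | ⟨h, _⟩)
        · exact hrs.trans (lt_upperHeight hΩ hb he hs)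
        · exact absurd hz h
    · have hem : {s : ℝ | (z : E n) + s • e ∈ Ω} = ∅ := by
        rw [eq_empty_iff_forall_notMem]
        exact fun s hs => hz ⟨s, hs⟩
      rw [upperHeight, hem, Real.sSup_empty]
      constructor
      · exact fun h => Or.inr ⟨hz, h⟩
      · rintro (⟨s, _, hs⟩ | ⟨_, h⟩)
        · exact absurd ⟨s, hs⟩ hz
        · exact h
  rw [this]
  exact (isOpen_shadow_above hΩ _).measurableSet.union
    ((isOpen_shadow hΩ).measurableSet.compl.inter (MeasurableSet.const _))

theorem measurable_exitPoint (hΩ : IsOpen Ω) (hb : Bornology.IsBounded Ω) (he : ‖e‖ = 1) :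
    Measurable (exitPoint Ω e) :=
  measurable_subtype_coe.add ((measurable_upperHeight hΩ hb he).smul_const e)

/-- Integration over exit points is dominated by the flux through the boundary. -/
theorem lintegral_exitPoint_le (hΩ : IsOpen Ω) (hc : Convex ℝ Ω)
    (hb : Bornology.IsBounded Ω) (hN : ∀ x ∈ frontier Ω, ∃ v, IsOuterNormal Ω x v)
    (he : ‖e‖ = 1) {Ψ : E n → ENNReal} (hΨ : Measurable Ψ) :
    ∫⁻ z in shadow Ω e, Ψ (exitPoint Ω e z) ≤
      ∫⁻ y, ENNReal.ofReal ⟪outerNormal Ω y, e⟫ * Ψ y ∂(surfaceMeasure Ω) := by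
  have htop := measurable_exitPoint hΩ hb he
  have hdens : AEMeasurable (fun y => ENNReal.ofReal ⟪outerNormal Ω y, e⟫)
      (surfaceMeasure Ω) :=
    ENNReal.measurable_ofReal.comp_aemeasurable
      ((continuousOn_outerNormal hΩ hc hN).inner continuousOn_const |>.aemeasurable
        isClosed_frontier.measurableSet)
  -- As an inequality of measures this needs checking only on measurable sets. Each `z` is the
  -- projection of its exit point, so the preimage of `A` lies in the projection of the part of `A`
  -- where the flux is positive.
  have hle : (volume.restrict (shadow Ω e)).map (exitPoint Ω e) ≤
      (surfaceMeasure Ω).withDensity fun y => ENNReal.ofReal ⟪outerNormal Ω y, e⟫ := by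
    refine Measure.le_iff.2 fun A hA => ?_
    set F := {y | y ∈ frontier Ω ∧ 0 < ⟪outerNormal Ω y, e⟫}
    have hF := measurableSet_frontier_inner_pos hΩ hc hN e
    rw [Measure.map_apply htop hA, Measure.restrict_apply (htop hA), withDensity_apply _ hA]
    calc volume (exitPoint Ω e ⁻¹' A ∩ shadow Ω e)
        ≤ volume ((ℝ ∙ e)ᗮ.orthogonalProjectionOnto '' (A ∩ F)) := by
          refine measure_mono fun z ⟨hzA, hz⟩ => ⟨exitPoint Ω e z, ⟨hzA,
            exitPoint_mem_frontier hΩ hb he hz,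
            inner_outerNormal_exitPoint_pos hΩ hc hb hN he hz⟩, projection_add_smul z _⟩
      _ ≤ ∫⁻ y in A ∩ F, ENNReal.ofReal ⟪outerNormal Ω y, e⟫
            ∂(Measure.euclideanHausdorffMeasure (n - 1)) :=
          volume_projection_le_lintegral hΩ hc hN he (hA.inter hF) inter_subset_right
      _ ≤ ∫⁻ y in A, ENNReal.ofReal ⟪outerNormal Ω y, e⟫ ∂(surfaceMeasure Ω) := by
          rw [surfaceMeasure, Measure.restrict_restrict hA]
          exact lintegral_mono_set fun y hy => ⟨hy.1, hy.2.1⟩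
  calc _ = ∫⁻ y, Ψ y ∂((volume.restrict (shadow Ω e)).map (exitPoint Ω e)) :=
        (lintegral_map hΨ htop).symm
    _ ≤ ∫⁻ y, Ψ y ∂((surfaceMeasure Ω).withDensity
          fun y => ENNReal.ofReal ⟪outerNormal Ω y, e⟫) := lintegral_mono' hle le_rfl
    _ = _ := by
        rw [lintegral_withDensity_eq_lintegral_mul₀' hdens hΨ.aemeasurable]
        rfl

end Surface

/-! ### The norm `H`, dual vectors and the polar function -/

section NormFacts

variable {n : ℕ} {p : ℝ} {H : E n → ℝ}

theorem IsAdmissibleNorm.nonneg (hH : IsAdmissibleNorm p H) (ξ : E n) : 0 ≤ H ξ := by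
  obtain ⟨a, b, ha, -, h⟩ := hH.comparable
  exact le_trans (by positivity) (h ξ).1

theorem IsAdmissibleNorm.pos (hH : IsAdmissibleNorm p H) {ξ : E n} (hξ : ξ ≠ 0) : 0 < H ξ := by
  obtain ⟨a, b, ha, -, h⟩ := hH.comparable
  have := norm_pos_iff.2 hξ
  exact lt_of_lt_of_le (by positivity) (h ξ).1

theorem IsAdmissibleNorm.map_zero (hH : IsAdmissibleNorm p H) : H 0 = 0 := by
  simpa using hH.homogeneous 0 0

theorem IsAdmissibleNorm.map_neg (hH : IsAdmissibleNorm p H) (ξ : E n) : H (-ξ) = H ξ := by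
  simpa using hH.homogeneous (-1) ξ

/-- The vectors normalized by `H` lie in the convex set `{H ≤ 1}`; their convex combination with
weights proportional to `H ξ` and `H η` is `ξ + η` divided by `H ξ + H η`. -/
theorem IsAdmissibleNorm.add_le (hH : IsAdmissibleNorm p H) (ξ η : E n) :
    H (ξ + η) ≤ H ξ + H η := by
  rcases eq_or_ne ξ 0 with rfl | hξ
  · simp [hH.map_zero]
  rcases eq_or_ne η 0 with rfl | hη
  · simp [hH.map_zero]
  have h1 := hH.pos hξ
  have h2 := hH.pos hη
  have hmem : ∀ ζ : E n, 0 < H ζ → (H ζ)⁻¹ • ζ ∈ {ξ : E n | H ξ ≤ 1} := by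
    intro ζ hζ
    change H ((H ζ)⁻¹ • ζ) ≤ 1
    rw [hH.homogeneous, abs_of_pos (inv_pos.2 hζ), inv_mul_cancel₀ hζ.ne']
  have hconv := (hH.strictConvex_level 1 one_pos).convex (hmem ξ h1) (hmem η h2)
    (a := H ξ / (H ξ + H η)) (b := H η / (H ξ + H η)) (by positivity) (by positivity)
    (by field_simp)
  have heq : (H ξ / (H ξ + H η)) • (H ξ)⁻¹ • ξ + (H η / (H ξ + H η)) • (H η)⁻¹ • η =
      (H ξ + H η)⁻¹ • (ξ + η) := by
    rw [smul_smul, smul_smul, smul_add]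
    congr 2 <;> field_simp
  rw [heq] at hconv
  have hconv : H ((H ξ + H η)⁻¹ • (ξ + η)) ≤ 1 := hconv
  rw [hH.homogeneous, abs_of_pos (by positivity), inv_mul_le_iff₀ (by positivity)] at hconv
  simpa using hconv

theorem IsAdmissibleNorm.abs_sub_le (hH : IsAdmissibleNorm p H) (ξ η : E n) :
    |H ξ - H η| ≤ H (ξ - η) := by
  rw [abs_le]
  have h1 := hH.add_le (ξ - η) η
  have h2 := hH.add_le (η - ξ) ξ
  rw [sub_add_cancel] at h1 h2
  rw [← hH.map_neg (ξ - η), neg_sub]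
  constructor
  · linarith
  · rw [← hH.map_neg (η - ξ), neg_sub]; linarith

theorem IsAdmissibleNorm.continuous (hH : IsAdmissibleNorm p H) : Continuous H := by
  obtain ⟨a, b, ha, hab, h⟩ := hH.comparable
  refine LipschitzWith.continuous (K := ⟨b, ha.le.trans hab⟩)
    (LipschitzWith.of_dist_le_mul fun ξ η => ?_)
  rw [Real.dist_eq, dist_eq_norm]
  exact (hH.abs_sub_le ξ η).trans (h _).2

/-- Every direction has a dual vector, by the Hahn-Banach theorem. -/
theorem IsAdmissibleNorm.exists_dual (hH : IsAdmissibleNorm p H) {ν : E n} (hν : ν ≠ 0) :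
    ∃ v : E n, ⟪v, ν⟫ = H ν ∧ ∀ ξ, |⟪v, ξ⟫| ≤ H ξ := by
  obtain ⟨g, hg, hgle⟩ := exists_extension_of_le_sublinear
    (LinearPMap.mkSpanSingleton (K := ℝ) ν (H ν) hν) H
    (fun c hc x => by rw [hH.homogeneous, abs_of_pos hc]) hH.add_le (by
      rintro ⟨x, hx⟩
      obtain ⟨c, rfl⟩ := Submodule.mem_span_singleton.1 hx
      rw [LinearPMap.mkSpanSingleton'_apply, hH.homogeneous]
      exact mul_le_mul_of_nonneg_right (le_abs_self c) (hH.nonneg ν))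
  set v := (InnerProductSpace.toDual ℝ (E n)).symm (LinearMap.toContinuousLinearMap g)
  have hv : ∀ ξ, ⟪v, ξ⟫ = g ξ := fun ξ => InnerProductSpace.toDual_symm_apply
  refine ⟨v, ?_, fun ξ => ?_⟩
  · rw [hv]
    have := hg ⟨ν, Submodule.mem_span_singleton_self ν⟩
    rw [this]
    exact LinearPMap.mkSpanSingleton_apply ℝ ℝ hν (H ν)
  · rw [hv, abs_le]
    have h1 := hgle (-ξ)
    rw [_root_.map_neg, hH.map_neg] at h1
    exact ⟨by linarith, hgle ξ⟩

theorem IsAdmissibleNorm.bddAbove_polar (hH : IsAdmissibleNorm p H) (v : E n) :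
    ∃ a : ℝ, 0 < a ∧ ∀ ξ : {ξ : E n // ξ ≠ 0}, ⟪(ξ : E n), v⟫ / H ξ ≤ ‖v‖ / a := by
  obtain ⟨a, b, ha, -, h⟩ := hH.comparable
  refine ⟨a, ha, fun ξ => ?_⟩
  rw [div_le_div_iff₀ (hH.pos ξ.2) ha]
  calc ⟪(ξ : E n), v⟫ * a ≤ ‖(ξ : E n)‖ * ‖v‖ * a := by
        gcongr; exact real_inner_le_norm _ _
    _ = ‖v‖ * (a * ‖(ξ : E n)‖) := by ring
    _ ≤ ‖v‖ * H ξ := by gcongr; exact (h ξ).1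

theorem IsAdmissibleNorm.inner_le_polar (hH : IsAdmissibleNorm p H) (ξ v : E n) :
    ⟪ξ, v⟫ ≤ H ξ * polar H v := by
  rcases eq_or_ne ξ 0 with rfl | hξ
  · simp [hH.map_zero]
  obtain ⟨a, -, ha⟩ := hH.bddAbove_polar v
  have := le_ciSup (f := fun ξ : {ξ : E n // ξ ≠ 0} => ⟪(ξ : E n), v⟫ / H ξ)
    ⟨_, forall_mem_range.2 ha⟩ ⟨ξ, hξ⟩
  have h2 : ⟪ξ, v⟫ / H ξ ≤ polar H v := this
  rw [div_le_iff₀ (hH.pos hξ)] at h2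
  linarith

theorem IsAdmissibleNorm.exists_polar_bounds (hH : IsAdmissibleNorm p H) (hn : 0 < n) :
    ∃ a b : ℝ, 0 < a ∧ 0 < b ∧ ∀ v : E n, a * ‖v‖ ≤ polar H v ∧ polar H v ≤ b * ‖v‖ := by
  obtain ⟨a, b, ha, hab, h⟩ := hH.comparable
  have hb := ha.trans_le hab
  have : Nonempty (Fin n) := ⟨⟨0, hn⟩⟩
  refine ⟨b⁻¹, a⁻¹, inv_pos.2 hb, inv_pos.2 ha, fun v => ⟨?_, ?_⟩⟩
  · rcases eq_or_ne v 0 with rfl | hv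
    · simp [polar]
    have h1 := hH.inner_le_polar v v
    have hv0 := norm_pos_iff.2 hv
    rw [real_inner_self_eq_norm_sq] at h1
    have hpol : 0 ≤ polar H v := by
      by_contra! hneg
      nlinarith [hH.pos hv, pow_pos hv0 2]
    rw [inv_mul_le_iff₀ hb]
    have h2 : ‖v‖ ^ 2 ≤ b * ‖v‖ * polar H v :=
      h1.trans (mul_le_mul_of_nonneg_right (h v).2 hpol)
    have h3 : ‖v‖ * ‖v‖ ≤ ‖v‖ * (b * polar H v) := by nlinarith
    exact le_of_mul_le_mul_left h3 hv0
  · obtain ⟨ξ, hξ⟩ := exists_ne (0 : E n)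
    have : Nonempty {ξ : E n // ξ ≠ 0} := ⟨⟨ξ, hξ⟩⟩
    refine ciSup_le fun ξ => ?_
    rw [div_le_iff₀ (hH.pos ξ.2)]
    calc ⟪(ξ : E n), v⟫ ≤ ‖(ξ : E n)‖ * ‖v‖ := real_inner_le_norm _ _
      _ = a⁻¹ * ‖v‖ * (a * ‖(ξ : E n)‖) := by field_simp
      _ ≤ a⁻¹ * ‖v‖ * H ξ := by gcongr; exact (h ξ).1

end NormFacts

/-! ### The one-dimensional inequality -/

section Line

/-- The constant of the one-dimensional inequality on an interval of length `R`. -/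
noncomputable def lineConst (p β R : ℝ) : ℝ := R * (1 + β ^ (1 / (p - 1)) * R) ^ (p - 1) / β

variable {p β R κ : ℝ}

theorem lineConst_pos (hβ : 0 < β) (hR : 0 < R) : 0 < lineConst p β R := by
  rw [lineConst]; positivity

/-- Convexity of the `p`-th power with weights `1 / (1 + θ)` and `θ / (1 + θ)`; the free parameter
`θ` later balances the boundary term against the energy. -/
theorem rpow_add_le_weighted (hp : 1 < p) {θ : ℝ} (hθ : 0 < θ) (x y : ENNReal) :
    (x + y) ^ p ≤ ENNReal.ofReal ((1 + θ) ^ (p - 1)) *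
      (x ^ p + ENNReal.ofReal (θ ^ (1 - p)) * y ^ p) := by
  have hp0 : 0 ≤ p := by linarith
  have h1 : 0 < 1 + θ := by linarith
  have hsum : ENNReal.ofReal (1 / (1 + θ)) + ENNReal.ofReal (θ / (1 + θ)) = 1 := by
    rw [← ENNReal.ofReal_add (by positivity) (by positivity), ← ENNReal.ofReal_one]
    congr 1; field_simp
  have h := ENNReal.rpow_arith_mean_le_arith_mean2_rpow _ _ (ENNReal.ofReal (1 + θ) * x)
    (ENNReal.ofReal ((1 + θ) / θ) * y) hsum hp.le
  rw [← mul_assoc, ← mul_assoc, ← ENNReal.ofReal_mul (by positivity),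
    ← ENNReal.ofReal_mul (by positivity), one_div_mul_cancel h1.ne',
    show θ / (1 + θ) * ((1 + θ) / θ) = 1 by field_simp, ENNReal.ofReal_one, one_mul, one_mul,
    ENNReal.mul_rpow_of_nonneg _ _ hp0, ENNReal.mul_rpow_of_nonneg _ _ hp0,
    ENNReal.ofReal_rpow_of_pos h1, ENNReal.ofReal_rpow_of_pos (by positivity),
    ← mul_assoc, ← mul_assoc, ← ENNReal.ofReal_mul (by positivity),
    ← ENNReal.ofReal_mul (by positivity)] at h
  refine h.trans_eq ?_
  rw [mul_add, ← mul_assoc, ← ENNReal.ofReal_mul (by positivity)]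
  congr 3
  · rw [Real.rpow_sub h1, Real.rpow_one]; field_simp
  · rw [Real.div_rpow h1.le hθ.le, Real.rpow_sub h1, Real.rpow_one, Real.rpow_sub hθ,
      Real.rpow_one]
    field_simp

theorem rpow_lintegral_le {α : Type*} [MeasurableSpace α] (μ : Measure α) (hp : 1 < p)
    {h : α → ENNReal} (hh : AEMeasurable h μ) :
    (∫⁻ s, h s ∂μ) ^ p ≤ μ univ ^ (p - 1) * ∫⁻ s, h s ^ p ∂μ := by
  have hp0 : 0 < p := by linarith
  have hpq := Real.HolderConjugate.conjExponent hp
  have H := ENNReal.lintegral_mul_le_Lp_mul_Lq μ hpq hh (aemeasurable_const (b := (1 : ENNReal)))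
  simp only [Pi.mul_apply, mul_one, ENNReal.one_rpow, lintegral_const, one_mul] at H
  calc _ ≤ ((∫⁻ s, h s ^ p ∂μ) ^ (1 / p) * μ univ ^ (1 / p.conjExponent)) ^ p :=
        ENNReal.rpow_le_rpow H hp0.le
    _ = _ := by
        rw [ENNReal.mul_rpow_of_nonneg _ _ hp0.le, ← ENNReal.rpow_mul, ← ENNReal.rpow_mul,
          one_div_mul_cancel hp0.ne', ENNReal.rpow_one, mul_comm]
        congr 2
        rw [Real.conjExponent]
        have : p - 1 ≠ 0 := by linarith
        field_simp

/-- The one-dimensional inequality: a function on a set of length at most `κ R` is controlled by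
its boundary value and its derivative. -/
theorem line_estimate (hp : 1 < p) (hβ : 0 < β) (hR : 0 < R) (hκ : 0 < κ) {S : Set ℝ}
    (hS : MeasurableSet S) (hvol : volume S ≤ ENNReal.ofReal (κ * R)) {f h : ℝ → ENNReal}
    (hh : Measurable h) {f₀ : ENNReal}
    (hf : ∀ s ∈ S, f s ≤ f₀ + ENNReal.ofReal κ⁻¹ * ∫⁻ t in S, h t) :
    ∫⁻ s in S, f s ^ p ≤ ENNReal.ofReal (lineConst p β R) *
      (ENNReal.ofReal (β * κ) * f₀ ^ p + ∫⁻ s in S, h s ^ p) := by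
  have hp0 : 0 < p := by linarith
  have hp1 : 0 < p - 1 := by linarith
  -- This choice gives `θ ^ (1 - p) = β⁻¹ * R ^ (1 - p)`. The power of `R` cancels against the one
  -- from Hölder's inequality, leaving the two terms in the ratio `β * κ : 1`.
  set θ := β ^ (1 / (p - 1)) * R
  have hθ : 0 < θ := by positivity
  have hθp : θ ^ (1 - p) = β⁻¹ * R ^ (1 - p) := by
    rw [Real.mul_rpow (by positivity) hR.le, ← Real.rpow_mul hβ.le, ← Real.rpow_neg_one]
    congr 2
    field_simp
    ring
  set I := ∫⁻ s in S, h s ^ p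
  have hI : (∫⁻ t in S, h t) ^ p ≤ ENNReal.ofReal ((κ * R) ^ (p - 1)) * I := by
    refine (rpow_lintegral_le _ hp hh.aemeasurable).trans ?_
    gcongr
    rw [Measure.restrict_apply_univ, ← ENNReal.ofReal_rpow_of_pos (by positivity)]
    exact ENNReal.rpow_le_rpow hvol hp1.le
  have hpt : ∀ s ∈ S, f s ^ p ≤ ENNReal.ofReal ((1 + θ) ^ (p - 1)) *
      (f₀ ^ p + ENNReal.ofReal (β * κ)⁻¹ * I) := by
    intro s hs
    refine (ENNReal.rpow_le_rpow (hf s hs) hp0.le).trans ?_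
    refine (rpow_add_le_weighted hp hθ _ _).trans ?_
    refine mul_le_mul' le_rfl (add_le_add le_rfl ?_)
    rw [ENNReal.mul_rpow_of_nonneg _ _ hp0.le]
    calc _ ≤ ENNReal.ofReal (θ ^ (1 - p)) * (ENNReal.ofReal κ⁻¹ ^ p *
          (ENNReal.ofReal ((κ * R) ^ (p - 1)) * I)) := by gcongr
      _ = _ := by
        rw [ENNReal.ofReal_rpow_of_pos (inv_pos.2 hκ), ← mul_assoc, ← mul_assoc,
          ← ENNReal.ofReal_mul (by positivity), ← ENNReal.ofReal_mul (by positivity)]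
        congr 2
        rw [hθp, Real.mul_rpow hκ.le hR.le, Real.inv_rpow hκ.le, Real.rpow_sub hκ,
          show 1 - p = -(p - 1) by ring, Real.rpow_neg hR.le, Real.rpow_one]
        field_simp
  calc ∫⁻ s in S, f s ^ p ≤ ∫⁻ _s in S, ENNReal.ofReal ((1 + θ) ^ (p - 1)) *
        (f₀ ^ p + ENNReal.ofReal (β * κ)⁻¹ * I) := setLIntegral_mono' hS hpt
    _ = ENNReal.ofReal ((1 + θ) ^ (p - 1)) * (f₀ ^ p + ENNReal.ofReal (β * κ)⁻¹ * I) *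
        volume S := setLIntegral_const _ _
    _ ≤ ENNReal.ofReal ((1 + θ) ^ (p - 1)) * (f₀ ^ p + ENNReal.ofReal (β * κ)⁻¹ * I) *
        ENNReal.ofReal (κ * R) := by gcongr
    _ = ENNReal.ofReal (κ * R * (1 + θ) ^ (p - 1)) *
        (f₀ ^ p + ENNReal.ofReal (β * κ)⁻¹ * I) := by
        rw [ENNReal.ofReal_mul (by positivity : 0 ≤ κ * R)]; ring
    _ = _ := by
        rw [mul_add, mul_add, ← mul_assoc, ← mul_assoc, ← ENNReal.ofReal_mul (by positivity),
          ← ENNReal.ofReal_mul (lineConst_pos hβ hR).le,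
          show lineConst p β R = R * (1 + θ) ^ (p - 1) / β from rfl]
        congr 3 <;> field_simp

end Line

/-! ### Integration of the line inequality over a cell -/

section Cell

variable {n : ℕ} {p β R κ : ℝ} {H : E n → ℝ} {Ω C : Set (E n)} {e : E n} {w : E n → ℝ}

theorem continuous_gradient (hw : ContDiff ℝ ∞ w) : Continuous (∇ w) :=
  (InnerProductSpace.toDual ℝ (E n)).symm.continuous.comp (hw.continuous_fderiv (by simp))

theorem hasDerivAt_line (hw : ContDiff ℝ ∞ w) (z e : E n) (s : ℝ) :
    HasDerivAt (fun s : ℝ => w (z + s • e)) ⟪∇ w (z + s • e), e⟫ s := by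
  have h1 : HasGradientAt w (∇ w (z + s • e)) (z + s • e) :=
    (hw.differentiable (by simp)).differentiableAt.hasGradientAt
  have h2 : HasDerivAt (fun s : ℝ => z + s • e) e s := by
    simpa using ((hasDerivAt_id s).smul_const e).const_add z
  exact h1.hasFDerivAt.comp_hasDerivAt s h2

/-- On a line inside `Ω`, a smooth function is controlled by its exit value and its anisotropic
derivative. -/
theorem enorm_line_le (hdual : ∀ ξ, |⟪κ • e, ξ⟫| ≤ H ξ) (hκ : 0 < κ) (hw : ContDiff ℝ ∞ w)
    {z : E n} {S : Set ℝ} {s t : ℝ} (hst : s ≤ t) (hS : Ico s t ⊆ S) :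
    ‖w (z + s • e)‖ₑ ≤ ‖w (z + t • e)‖ₑ +
      ENNReal.ofReal κ⁻¹ * ∫⁻ r in S, ENNReal.ofReal (H (∇ w (z + r • e))) := by
  set f : ℝ → ℝ := fun s => w (z + s • e)
  have hf : ContDiff ℝ 1 f := (hw.of_le (by simp)).comp (by fun_prop)
  have h1 := enorm_sub_le_lintegral_deriv_of_contDiffOn_Icc hf.contDiffOn hst
  have h2 : ∫⁻ r in Icc s t, ‖deriv f r‖ₑ ≤
      ENNReal.ofReal κ⁻¹ * ∫⁻ r in S, ENNReal.ofReal (H (∇ w (z + r • e))) := by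
    -- The endpoint `t` is dropped because in the application it is the exit point, which is not in
    -- `Ω`.
    rw [setLIntegral_congr Ico_ae_eq_Icc.symm, ← lintegral_const_mul' _ _ ENNReal.ofReal_ne_top]
    refine (lintegral_mono_set hS).trans (lintegral_mono fun r => ?_)
    rw [(hasDerivAt_line hw z e r).deriv, ← ENNReal.ofReal_mul (inv_pos.2 hκ).le,
      Real.enorm_eq_ofReal_abs]
    apply ENNReal.ofReal_le_ofReal
    have h3 := hdual (∇ w (z + r • e))
    rw [real_inner_smul_left, abs_mul, abs_of_pos hκ, real_inner_comm] at h3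
    rwa [le_inv_mul_iff₀ hκ]
  calc ‖f s‖ₑ = ‖f t - (f t - f s)‖ₑ := by rw [sub_sub_cancel]
    _ ≤ ‖f t‖ₑ + ‖f t - f s‖ₑ := enorm_sub_le
    _ ≤ _ := add_le_add le_rfl (h1.trans h2)

/-- The inequality on a cell swept by segments in direction `e` that end at the boundary. -/
theorem cell_estimate (hp : 1 < p) (hβ : 0 < β) (hR : 0 < R) (hκ : 0 < κ)
    (hH : IsAdmissibleNorm p H) (hΩ : IsOpen Ω) (hc : Convex ℝ Ω) (hb : Bornology.IsBounded Ω)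
    (hN : ∀ x ∈ frontier Ω, ∃ v, IsOuterNormal Ω x v) (he : ‖e‖ = 1)
    (hdual : ∀ ξ, |⟪κ • e, ξ⟫| ≤ H ξ) (hC : MeasurableSet C) (hCΩ : C ⊆ Ω)
    (hup : ∀ x ∈ C, ∀ t : ℝ, 0 ≤ t → x + t • e ∈ Ω → x + t • e ∈ C ∧ t ≤ κ * R)
    {A : Set (E n)} (hA : MeasurableSet A)
    (hexit : ∀ (z : (ℝ ∙ e)ᗮ) (s : ℝ), (z : E n) + s • e ∈ C → exitPoint Ω e z ∈ A)
    (hw : ContDiff ℝ ∞ w) :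
    ∫⁻ x in C, ‖w x‖ₑ ^ p ≤ ENNReal.ofReal (lineConst p β R) *
      (ENNReal.ofReal β * ∫⁻ y in A, ENNReal.ofReal (H (outerNormal Ω y)) * ‖w y‖ₑ ^ p
          ∂(surfaceMeasure Ω) +
        ∫⁻ x in C, ENNReal.ofReal (H (∇ w x)) ^ p) := by
  have hp0 : 0 < p := by linarith
  set F : E n → ENNReal := fun x => ‖w x‖ₑ ^ p
  have hF : Measurable F := (hw.continuous.measurable.enorm).pow_const p
  set h : E n → ENNReal := fun x => ENNReal.ofReal (H (∇ w x))
  have hh : Measurable h :=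
    (hH.continuous.comp (continuous_gradient hw)).measurable.ennreal_ofReal
  have hhp : Measurable fun x => h x ^ p := hh.pow_const p
  have hS : ∀ z : (ℝ ∙ e)ᗮ, MeasurableSet {s : ℝ | (z : E n) + s • e ∈ C} := fun z =>
    (continuous_line (z : E n) e).measurable hC
  have hlines : ∀ {g : E n → ENNReal}, Measurable g → ∫⁻ x in C, g x =
      ∫⁻ z : (ℝ ∙ e)ᗮ, ∫⁻ s in {s : ℝ | (z : E n) + s • e ∈ C}, g ((z : E n) + s • e) := by
    intro g hg
    rw [← lintegral_indicator hC, lintegral_lines he (hg.indicator hC)]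
    refine lintegral_congr fun z => ?_
    rw [← lintegral_indicator (hS z)]
    rfl
  set Ψ : E n → ENNReal := A.indicator F
  have hΨ : Measurable Ψ := hF.indicator hA
  set T : (ℝ ∙ e)ᗮ → ENNReal := (shadow Ω e).indicator fun z => Ψ (exitPoint Ω e z)
  have hpt : ∀ z : (ℝ ∙ e)ᗮ,
      ∫⁻ s in {s : ℝ | (z : E n) + s • e ∈ C}, F ((z : E n) + s • e) ≤
        ENNReal.ofReal (lineConst p β R) * (ENNReal.ofReal (β * κ) * T z +
          ∫⁻ s in {s : ℝ | (z : E n) + s • e ∈ C}, h ((z : E n) + s • e) ^ p) := by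
    intro z
    by_cases hz : ∃ s : ℝ, (z : E n) + s • e ∈ C
    · obtain ⟨s₀, hs₀⟩ := hz
      have hzs : z ∈ shadow Ω e := ⟨s₀, hCΩ hs₀⟩
      have hT : T z = ‖w (exitPoint Ω e z)‖ₑ ^ p := by
        simp only [T, Ψ]
        rw [indicator_of_mem hzs, indicator_of_mem (hexit z s₀ hs₀)]
      have hstep : ∀ s, (z : E n) + s • e ∈ C → ∀ t, s ≤ t → t < upperHeight Ω e z →
          (z : E n) + t • e ∈ C ∧ t - s ≤ κ * R := by
        intro s hs t hst ht
        have h1 := line_mem_of_lt_upperHeight hc (hCΩ hs) hst ht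
        have h2 : (z : E n) + t • e = (z : E n) + s • e + (t - s) • e := by module
        have h3 := hup _ hs (t - s) (sub_nonneg.2 hst) (by rwa [← h2])
        rwa [← h2] at h3
      rw [hT]
      refine line_estimate hp hβ hR hκ (hS z) ?_
        (f := fun s => ‖w ((z : E n) + s • e)‖ₑ)
        (h := fun s => h ((z : E n) + s • e))
        (hh.comp (continuous_line (z : E n) e).measurable) ?_
      -- The length bound applies only to points of `Ω`, hence to parameters strictly below the exit
      -- height. A point of the cell further than `κ * R` below that height would leave room for one
      -- violating the bound.
      · have hsub : {s : ℝ | (z : E n) + s • e ∈ C} ⊆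
            Icc (upperHeight Ω e z - κ * R) (upperHeight Ω e z) := by
          intro s hs
          have hlt := lt_upperHeight hΩ hb he (hCΩ hs)
          refine ⟨?_, hlt.le⟩
          by_contra! hlt2
          obtain ⟨t, ht1, ht2⟩ := exists_between
            (max_lt hlt (by linarith : s + κ * R < upperHeight Ω e z))
          have := (hstep s hs t ((le_max_left _ _).trans ht1.le) ht2).2
          linarith [(le_max_right s (s + κ * R)).trans_lt ht1]
        refine (measure_mono hsub).trans_eq ?_
        rw [Real.volume_Icc, sub_sub_cancel]
      · intro s hs
        exact enorm_line_le hdual hκ hw (lt_upperHeight hΩ hb he (hCΩ hs)).le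
          fun t ht => (hstep s hs t ht.1 ht.2).1
    · have : {s : ℝ | (z : E n) + s • e ∈ C} = ∅ := by
        rw [eq_empty_iff_forall_notMem]
        exact fun s hs => hz ⟨s, hs⟩
      simp [this]
  have hmeas : Measurable fun z : (ℝ ∙ e)ᗮ =>
      ∫⁻ s in {s : ℝ | (z : E n) + s • e ∈ C}, h ((z : E n) + s • e) ^ p := by
    have h1 : Measurable fun q : (ℝ ∙ e)ᗮ × ℝ =>
        C.indicator (fun x => h x ^ p) ((q.1 : E n) + q.2 • e) :=
      (hhp.indicator hC).comp (by fun_prop)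
    convert! h1.lintegral_prod_right' (ν := volume) using 2 with z
    rw [← lintegral_indicator (hS z)]
    rfl
  -- The factor `κ` restores the dual vector: `κ * ⟪ν, e⟫ = ⟪κ • e, ν⟫ ≤ H ν`.
  have hTint : ENNReal.ofReal κ * ∫⁻ z, T z ≤
      ∫⁻ y in A, ENNReal.ofReal (H (outerNormal Ω y)) * F y ∂(surfaceMeasure Ω) := by
    rw [lintegral_indicator (isOpen_shadow hΩ).measurableSet]
    calc _ ≤ ENNReal.ofReal κ *
          ∫⁻ y, ENNReal.ofReal ⟪outerNormal Ω y, e⟫ * Ψ y ∂(surfaceMeasure Ω) := by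
          gcongr
          exact lintegral_exitPoint_le hΩ hc hb hN he hΨ
      _ = ∫⁻ y, ENNReal.ofReal κ * (ENNReal.ofReal ⟪outerNormal Ω y, e⟫ * Ψ y)
            ∂(surfaceMeasure Ω) := (lintegral_const_mul' _ _ ENNReal.ofReal_ne_top).symm
      _ ≤ ∫⁻ y, A.indicator (fun y => ENNReal.ofReal (H (outerNormal Ω y)) * F y) y
            ∂(surfaceMeasure Ω) := by
          refine lintegral_mono fun y => ?_
          by_cases hy : y ∈ A
          · simp only [Ψ]
            rw [indicator_of_mem hy, indicator_of_mem hy, ← mul_assoc,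
              ← ENNReal.ofReal_mul hκ.le]
            gcongr
            have := (le_abs_self _).trans (hdual (outerNormal Ω y))
            rwa [real_inner_smul_left, real_inner_comm] at this
          · simp [Ψ, hy]
      _ = _ := lintegral_indicator hA _
  rw [hlines hF, hlines hhp]
  calc _ ≤ ∫⁻ z : (ℝ ∙ e)ᗮ, ENNReal.ofReal (lineConst p β R) *
        (ENNReal.ofReal (β * κ) * T z +
          ∫⁻ s in {s : ℝ | (z : E n) + s • e ∈ C}, h ((z : E n) + s • e) ^ p) :=
        lintegral_mono hpt
    _ = ENNReal.ofReal (lineConst p β R) * (ENNReal.ofReal (β * κ) * (∫⁻ z, T z) +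
          ∫⁻ z : (ℝ ∙ e)ᗮ, ∫⁻ s in {s : ℝ | (z : E n) + s • e ∈ C},
            h ((z : E n) + s • e) ^ p) := by
        rw [lintegral_const_mul' _ _ ENNReal.ofReal_ne_top, lintegral_add_right _ hmeas,
          lintegral_const_mul' _ _ ENNReal.ofReal_ne_top]
    _ ≤ _ := by
        rw [ENNReal.ofReal_mul hβ.le, mul_assoc]
        gcongr

end Cell

/-! ### Anisotropic inradius and supporting hyperplanes -/

section Inradius

variable {n : ℕ} {p : ℝ} {H : E n → ℝ} {Ω : Set (E n)}

theorem frontier_nonempty (hn : 0 < n) (hne : Ω.Nonempty) (hb : Bornology.IsBounded Ω) :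
    (frontier Ω).Nonempty := by
  have : Nonempty (Fin n) := ⟨⟨0, hn⟩⟩
  refine nonempty_frontier_iff.2 ⟨hne, ?_⟩
  rintro rfl
  exact NormedSpace.unbounded_univ ℝ (E n) hb

theorem bddBelow_polar_frontier (hn : 0 < n) (hH : IsAdmissibleNorm p H) (x : E n) :
    BddBelow (range fun y : frontier Ω => polar H (x - y)) := by
  obtain ⟨a, b, ha, hb, h⟩ := hH.exists_polar_bounds hn
  exact ⟨0, forall_mem_range.2 fun y => le_trans (by positivity) (h _).1⟩

theorem bddAbove_anisoDist (hn : 0 < n) (hH : IsAdmissibleNorm p H) (hne : Ω.Nonempty)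
    (hb : Bornology.IsBounded Ω) : BddAbove (range fun x : Ω => anisoDist H Ω x) := by
  obtain ⟨a, b, ha, hb0, h⟩ := hH.exists_polar_bounds hn
  obtain ⟨y, hy⟩ := frontier_nonempty hn hne hb
  obtain ⟨M, hM⟩ := hb.exists_norm_le
  refine ⟨b * (M + ‖y‖), forall_mem_range.2 fun x => ?_⟩
  refine (ciInf_le (bddBelow_polar_frontier hn hH (x : E n)) ⟨y, hy⟩).trans ?_
  refine (h _).2.trans ?_
  gcongr
  exact (norm_sub_le _ _).trans (add_le_add_left (hM _ x.2) _)

theorem anisoDist_le_anisoInradius (hn : 0 < n) (hH : IsAdmissibleNorm p H)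
    (hb : Bornology.IsBounded Ω) {x : E n} (hx : x ∈ Ω) :
    anisoDist H Ω x ≤ anisoInradius H Ω :=
  le_ciSup (f := fun x : Ω => anisoDist H Ω x) (bddAbove_anisoDist hn hH ⟨x, hx⟩ hb) ⟨x, hx⟩

theorem anisoInradius_pos (hn : 0 < n) (hH : IsAdmissibleNorm p H) (hΩ : IsOpen Ω)
    (hne : Ω.Nonempty) (hb : Bornology.IsBounded Ω) : 0 < anisoInradius H Ω := by
  obtain ⟨x, hx⟩ := hne
  obtain ⟨a, b, ha, hb0, h⟩ := hH.exists_polar_bounds hn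
  obtain ⟨r, hr, hball⟩ := Metric.isOpen_iff.1 hΩ x hx
  have : Nonempty (frontier Ω) := (frontier_nonempty hn ⟨x, hx⟩ hb).to_subtype
  have hle : a * r ≤ anisoDist H Ω x := by
    refine le_ciInf fun y => ?_
    refine le_trans ?_ (h _).1
    gcongr
    by_contra! hlt
    refine (hΩ.frontier_eq.subset y.2).2 (hball ?_)
    rwa [Metric.mem_ball, dist_comm, dist_eq_norm]
  exact lt_of_lt_of_le (by positivity) (hle.trans (anisoDist_le_anisoInradius hn hH hb hx))

/-- The anisotropic distance from `x` to the supporting hyperplane at the boundary point `y`. -/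
noncomputable def supportDist (H : E n → ℝ) (Ω : Set (E n)) (y x : E n) : ℝ :=
  ⟪y - x, outerNormal Ω y⟫ / H (outerNormal Ω y)

theorem continuous_supportDist (y : E n) : Continuous (supportDist H Ω y) := by
  unfold supportDist
  fun_prop

/-- The vector `-outerNormal Ω y` is one of the competitors in the supremum that defines the polar
function. -/
theorem supportDist_le_polar (hH : IsAdmissibleNorm p H) {y : E n} (hν : outerNormal Ω y ≠ 0)
    (x : E n) : supportDist H Ω y x ≤ polar H (x - y) := by
  rw [supportDist, div_le_iff₀ (hH.pos hν)]
  have := hH.inner_le_polar (-outerNormal Ω y) (x - y)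
  rwa [hH.map_neg, ← inner_neg_neg, neg_neg, neg_sub, real_inner_comm, mul_comm] at this

theorem outerNormal_ne_zero {y : E n} (h : ∃ v, IsOuterNormal Ω y v) : outerNormal Ω y ≠ 0 := by
  rw [← norm_ne_zero_iff, (isOuterNormal_outerNormal h).1]
  exact one_ne_zero

/-- Finitely many supporting hyperplanes determine the inradius up to a small error. -/
theorem exists_finset_supportDist_lt (hn : 0 < n) (hH : IsAdmissibleNorm p H)
    (hb : Bornology.IsBounded Ω) (hN : ∀ x ∈ frontier Ω, ∃ v, IsOuterNormal Ω x v)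
    {R : ℝ} (hR0 : 0 < R) (hR : anisoInradius H Ω < R) :
    ∃ t : Finset (E n), (∀ y ∈ t, y ∈ frontier Ω) ∧
      ∀ x ∈ closure Ω, ∃ y ∈ t, supportDist H Ω y x < R := by
  have hK : IsCompact (closure Ω) := hb.isCompact_closure
  -- For `x` in `Ω`, take a boundary point at polar distance less than `R`. For `x` on the boundary,
  -- take `x` itself, at distance zero from its own hyperplane.
  have hcov : closure Ω ⊆ ⋃ y ∈ frontier Ω, {x | supportDist H Ω y x < R} := by
    intro x hx
    simp only [mem_iUnion, exists_prop]
    rcases em (x ∈ Ω) with hxΩ | hxΩ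
    · have : Nonempty (frontier Ω) := (frontier_nonempty hn ⟨x, hxΩ⟩ hb).to_subtype
      obtain ⟨y, hy⟩ := exists_lt_of_ciInf_lt
        ((anisoDist_le_anisoInradius hn hH hb hxΩ).trans_lt hR)
      exact ⟨y, y.2, (supportDist_le_polar hH (outerNormal_ne_zero (hN y y.2)) x).trans_lt hy⟩
    · refine ⟨x, ⟨hx, fun h => hxΩ (interior_subset h)⟩, ?_⟩
      change supportDist H Ω x x < R
      simpa [supportDist] using hR0
  obtain ⟨b, hbf, hfin, hsub⟩ := hK.elim_finite_subcover_image
    (fun y _ => isOpen_lt (continuous_supportDist y) continuous_const) hcov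
  refine ⟨hfin.toFinset, fun y hy => hbf (hfin.mem_toFinset.1 hy), fun x hx => ?_⟩
  have := hsub hx
  simp only [mem_iUnion, exists_prop] at this
  obtain ⟨y, hy, hlt⟩ := this
  exact ⟨y, hfin.mem_toFinset.2 hy, hlt⟩

end Inradius

/-! ### Partition by the first minimizing index -/

section FirstArgmin

/-- The points where `i` is the first index that minimizes `δ i`. -/
def firstArgmin {X : Type*} {N : ℕ} (δ : Fin N → X → ℝ) (i : Fin N) : Set X :=
  {x | (∀ j, δ i x ≤ δ j x) ∧ ∀ j < i, δ i x < δ j x}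

variable {X : Type*} {N : ℕ} {δ : Fin N → X → ℝ}

theorem exists_mem_firstArgmin (i₀ : Fin N) (x : X) : ∃ i, x ∈ firstArgmin δ i := by
  classical
  have : Nonempty (Fin N) := ⟨i₀⟩
  obtain ⟨k, hk⟩ := Finite.exists_min fun i => δ i x
  have hne : {i | ∀ j, δ i x ≤ δ j x}.Nonempty := ⟨k, hk⟩
  obtain ⟨i, hi, hmin⟩ := wellFounded_lt.has_min _ hne
  refine ⟨i, hi, fun j hj => ?_⟩
  by_contra! hle
  exact hmin j (fun l => hle.trans (hi l)) hj

theorem pairwise_disjoint_firstArgmin : Pairwise (Function.onFun Disjoint (firstArgmin δ)) := by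
  intro i j hij
  refine disjoint_left.2 fun x hi hj => ?_
  rcases lt_or_gt_of_ne hij with h | h
  · exact absurd (hj.2 i h) (hi.1 j).not_gt
  · exact absurd (hi.2 j h) (hj.1 i).not_gt

theorem measurableSet_firstArgmin [MeasurableSpace X] (hδ : ∀ i, Measurable (δ i)) (i : Fin N) :
    MeasurableSet (firstArgmin δ i) := by
  have : firstArgmin δ i =
      (⋂ j, {x | δ i x ≤ δ j x}) ∩ ⋂ j, ⋂ (_ : j < i), {x | δ i x < δ j x} := by
    ext x; simp [firstArgmin]
  rw [this]
  exact (MeasurableSet.iInter fun j => measurableSet_le (hδ i) (hδ j)).inter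
    (MeasurableSet.iInter fun j => MeasurableSet.iInter fun _ =>
      measurableSet_lt (hδ i) (hδ j))

/-- The constants are the same for every cell and the sets `A i` are disjoint, so summing the cell
inequalities counts no part of the boundary twice. -/
theorem lintegral_le_of_cells [MeasurableSpace X] {μ σ : Measure X} {ι : Type*} [Countable ι]
    {Ω : Set X} {A : ι → Set X} (hA : ∀ i, MeasurableSet (A i))
    (hdisj : Pairwise (Function.onFun Disjoint A)) (hΩ : MeasurableSet Ω) (hcov : Ω ⊆ ⋃ i, A i)
    {F G h : X → ENNReal} {K b : ENNReal}
    (hcell : ∀ i, ∫⁻ x in Ω ∩ A i, F x ∂μ ≤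
      K * (b * ∫⁻ y in A i, G y ∂σ + ∫⁻ x in Ω ∩ A i, h x ∂μ)) :
    ∫⁻ x in Ω, F x ∂μ ≤ K * (b * ∫⁻ y, G y ∂σ + ∫⁻ x in Ω, h x ∂μ) := by
  have hΩC : ⋃ i, Ω ∩ A i = Ω := by rwa [← inter_iUnion, inter_eq_left]
  have hsum : ∫⁻ x in Ω, h x ∂μ = ∑' i, ∫⁻ x in Ω ∩ A i, h x ∂μ := by
    rw [← lintegral_iUnion (fun i => hΩ.inter (hA i)) fun i j hij =>
      (hdisj hij).mono inter_subset_right inter_subset_right, hΩC]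
  calc ∫⁻ x in Ω, F x ∂μ = ∫⁻ x in ⋃ i, Ω ∩ A i, F x ∂μ := by rw [hΩC]
    _ ≤ ∑' i, ∫⁻ x in Ω ∩ A i, F x ∂μ := lintegral_iUnion_le _ _
    _ ≤ ∑' i, K * (b * ∫⁻ y in A i, G y ∂σ + ∫⁻ x in Ω ∩ A i, h x ∂μ) :=
      ENNReal.tsum_le_tsum hcell
    _ = K * (b * ∫⁻ y in ⋃ i, A i, G y ∂σ + ∫⁻ x in Ω, h x ∂μ) := by
      rw [ENNReal.tsum_mul_left, ENNReal.tsum_add, ENNReal.tsum_mul_left,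
        lintegral_iUnion hA hdisj, hsum]
    _ ≤ _ := by
      gcongr
      exact Measure.restrict_le_self

end FirstArgmin

/-! ### The Robin-Poincaré inequality for smooth functions -/

section Smooth

variable {n : ℕ} {p β R : ℝ} {H : E n → ℝ} {Ω : Set (E n)} {w : E n → ℝ}

/-- The cells are the regions where a given one of finitely many supporting hyperplanes is nearest,
each swept in the direction dual to its normal. The slack between `R` and the inradius is what
allows finitely many hyperplanes. -/
theorem smooth_estimate_of_lt (hn : 0 < n) (hp : 1 < p) (hβ : 0 < β) (hH : IsAdmissibleNorm p H)
    (hΩ : IsOpen Ω) (hc : Convex ℝ Ω) (hb : Bornology.IsBounded Ω)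
    (hN : ∀ x ∈ frontier Ω, ∃ v, IsOuterNormal Ω x v) (hR0 : 0 < R)
    (hR : anisoInradius H Ω < R) (hw : ContDiff ℝ ∞ w) :
    ∫⁻ x in Ω, ‖w x‖ₑ ^ p ≤ ENNReal.ofReal (lineConst p β R) *
      (ENNReal.ofReal β * ∫⁻ y, ENNReal.ofReal (H (outerNormal Ω y)) * ‖w y‖ₑ ^ p
          ∂(surfaceMeasure Ω) +
        ∫⁻ x in Ω, ENNReal.ofReal (H (∇ w x)) ^ p) := by
  obtain ⟨t, htf, hcov⟩ := exists_finset_supportDist_lt hn hH hb hN hR0 hR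
  set Y : Fin t.card → E n := fun i => (t.equivFin.symm i : E n)
  have hY : ∀ i, Y i ∈ frontier Ω := fun i => htf _ (t.equivFin.symm i).2
  have hcov' : ∀ x ∈ closure Ω, ∃ i, supportDist H Ω (Y i) x < R := by
    intro x hx
    obtain ⟨y, hy, hlt⟩ := hcov x hx
    exact ⟨t.equivFin ⟨y, hy⟩, by simpa [Y] using hlt⟩
  set δ : Fin t.card → E n → ℝ := fun i => supportDist H Ω (Y i)
  set A := firstArgmin δ
  have hA : ∀ i, MeasurableSet (A i) :=
    measurableSet_firstArgmin fun i => (continuous_supportDist (Y i)).measurable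
  have hC : ∀ i, MeasurableSet (Ω ∩ A i) := fun i => hΩ.measurableSet.inter (hA i)
  have hcell : ∀ i, ∫⁻ x in Ω ∩ A i, ‖w x‖ₑ ^ p ≤ ENNReal.ofReal (lineConst p β R) *
      (ENNReal.ofReal β * ∫⁻ y in A i, ENNReal.ofReal (H (outerNormal Ω y)) * ‖w y‖ₑ ^ p
          ∂(surfaceMeasure Ω) +
        ∫⁻ x in Ω ∩ A i, ENNReal.ofReal (H (∇ w x)) ^ p) := by
    intro i
    have hν0 := fun j => outerNormal_ne_zero (hN _ (hY j))
    obtain ⟨v, hv, hdual⟩ := hH.exists_dual (hν0 i)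
    have hv0 : v ≠ 0 := by
      rintro rfl
      rw [inner_zero_left] at hv
      exact (hH.pos (hν0 i)).ne hv
    have hκ : 0 < ‖v‖ := norm_pos_iff.2 hv0
    set e := ‖v‖⁻¹ • v
    have hve : ‖v‖ • e = v := smul_inv_smul₀ hκ.ne' v
    have he : ‖e‖ = 1 := by rw [norm_smul, norm_inv, norm_norm, inv_mul_cancel₀ hκ.ne']
    have hshift : ∀ j x s, δ j (x + s • e) =
        δ j x - s * ⟪e, outerNormal Ω (Y j)⟫ / H (outerNormal Ω (Y j)) := by
      intro j x s
      simp only [δ, supportDist]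
      rw [← sub_sub, inner_sub_left, real_inner_smul_left, sub_div]
    have hev : ∀ j, ⟪e, outerNormal Ω (Y j)⟫ = ‖v‖⁻¹ * ⟪v, outerNormal Ω (Y j)⟫ :=
      fun j => real_inner_smul_left _ _ _
    have hshift_i : ∀ x s, δ i (x + s • e) = δ i x - s / ‖v‖ := by
      intro x s
      rw [hshift, hev, hv]
      have := (hH.pos (hν0 i)).ne'
      field_simp
    have hshift_j : ∀ j x s, 0 ≤ s → δ j x - s / ‖v‖ ≤ δ j (x + s • e) := by
      intro j x s hs
      rw [hshift, hev]
      have h1 := hH.pos (hν0 j)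
      have h2 := (le_abs_self _).trans (hdual (outerNormal Ω (Y j)))
      have h3 : s * (‖v‖⁻¹ * ⟪v, outerNormal Ω (Y j)⟫) / H (outerNormal Ω (Y j)) ≤ s / ‖v‖ := by
        rw [div_le_div_iff₀ h1 hκ]
        calc _ = s * ⟪v, outerNormal Ω (Y j)⟫ := by field_simp
          _ ≤ _ := by gcongr
      linarith
    -- Along `e` the distance `δ i` drops at rate `1 / ‖v‖` and every other `δ j` at no greater
    -- rate, so index `i` remains the first minimizer.
    have hstay : ∀ x ∈ A i, ∀ s : ℝ, 0 ≤ s → x + s • e ∈ A i := by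
      intro x hx s hs
      refine ⟨fun j => ?_, fun j hj => ?_⟩
      · rw [hshift_i]
        linarith [hshift_j j x s hs, hx.1 j]
      · rw [hshift_i]
        linarith [hshift_j j x s hs, hx.2 j hj]
    refine cell_estimate (κ := ‖v‖) (e := e) hp hβ hR0 hκ hH hΩ hc hb hN he
      (by rwa [hve]) (hC i) inter_subset_left ?_ (hA i) ?_ hw
    · intro x hx s hs hxs
      refine ⟨⟨hxs, hstay x hx.2 s hs⟩, ?_⟩
      obtain ⟨j, hj⟩ := hcov' x (subset_closure hx.1)
      have h1 : δ i x < R := (hx.2.1 j).trans_lt hj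
      have h2 : 0 < δ i (x + s • e) := by
        -- Inside `Ω` the distance `δ i` is still positive; it started below `R` and has dropped by
        -- `s / ‖v‖`, so `s < ‖v‖ * R`.
        have := (isOuterNormal_outerNormal (hN _ (hY i))).inner_neg hΩ hc (hY i) hxs
        refine div_pos ?_ (hH.pos (hν0 i))
        rw [← neg_sub, inner_neg_left]
        linarith
      rw [hshift_i] at h2
      have h3 : s / ‖v‖ < R := by linarith
      rw [div_lt_iff₀ hκ] at h3
      linarith
    · intro z s hs
      have hlt := lt_upperHeight hΩ hb he hs.1
      have : exitPoint Ω e z = (z : E n) + s • e + (upperHeight Ω e z - s) • e := by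
        rw [exitPoint]; module
      rw [this]
      exact hstay _ hs.2 _ (sub_nonneg.2 hlt.le)
  refine lintegral_le_of_cells hA pairwise_disjoint_firstArgmin hΩ.measurableSet
    (fun x hx => ?_) hcell
  obtain ⟨i₀, _⟩ := hcov' x (subset_closure hx)
  exact mem_iUnion.2 (exists_mem_firstArgmin i₀ x)

/-- The Robin-Poincaré inequality for smooth functions on a convex domain with normals. -/
theorem smooth_estimate (hn : 0 < n) (hp : 1 < p) (hβ : 0 < β) (hH : IsAdmissibleNorm p H)
    (hΩ : IsOpen Ω) (hne : Ω.Nonempty) (hc : Convex ℝ Ω) (hb : Bornology.IsBounded Ω)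
    (hN : ∀ x ∈ frontier Ω, ∃ v, IsOuterNormal Ω x v) (hw : ContDiff ℝ ∞ w) :
    ∫⁻ x in Ω, ‖w x‖ₑ ^ p ≤ ENNReal.ofReal (lineConst p β (anisoInradius H Ω)) *
      (ENNReal.ofReal β * ∫⁻ y, ENNReal.ofReal (H (outerNormal Ω y)) * ‖w y‖ₑ ^ p
          ∂(surfaceMeasure Ω) +
        ∫⁻ x in Ω, ENNReal.ofReal (H (∇ w x)) ^ p) := by
  have hR := anisoInradius_pos hn hH hΩ hne hb
  set r := anisoInradius H Ω
  have hcont : ContinuousAt (lineConst p β) r := by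
    unfold lineConst
    refine (continuousAt_id.mul (ContinuousAt.rpow_const (by fun_prop) (Or.inl ?_))).div_const _
    positivity
  have hlim : Tendsto (fun R => ENNReal.ofReal (lineConst p β R)) (𝓝[>] r)
      (𝓝 (ENNReal.ofReal (lineConst p β r))) :=
    (ENNReal.continuous_ofReal.continuousAt.comp hcont).tendsto.mono_left nhdsWithin_le_nhds
  refine ge_of_tendsto (ENNReal.Tendsto.mul_const hlim (Or.inl ?_)) ?_
  · exact (ENNReal.ofReal_pos.2 (lineConst_pos hβ hR)).ne'
  · filter_upwards [self_mem_nhdsWithin] with R hRr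
    exact smooth_estimate_of_lt hn hp hβ hH hΩ hc hb hN (hR.trans hRr) hRr hw

end Smooth

/-! ### Convergence and integral formulas for `L^p` norms -/

section Lp

variable {X F : Type*} [MeasurableSpace X] {μ : Measure X} [NormedAddCommGroup F]

theorem tendsto_eLpNorm_of_tendsto_sub {q : ENNReal} (hq : 1 ≤ q) {f : ℕ → X → F} {g : X → F}
    (hf : ∀ k, AEStronglyMeasurable (f k) μ) (hg : MemLp g q μ)
    (h : Tendsto (fun k => eLpNorm (fun x => f k x - g x) q μ) atTop (𝓝 0)) :
    Tendsto (fun k => eLpNorm (f k) q μ) atTop (𝓝 (eLpNorm g q μ)) := by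
  have hup : ∀ k, eLpNorm (f k) q μ ≤ eLpNorm g q μ + eLpNorm (fun x => f k x - g x) q μ := by
    intro k
    have := eLpNorm_add_le hg.1 ((hf k).sub hg.1) hq
    rwa [add_sub_cancel] at this
  have hlow : ∀ k, eLpNorm g q μ - eLpNorm (fun x => f k x - g x) q μ ≤ eLpNorm (f k) q μ := by
    intro k
    rw [tsub_le_iff_right]
    have := eLpNorm_sub_le (hf k) ((hf k).sub hg.1) hq
    rwa [sub_sub_cancel] at this
  refine tendsto_of_tendsto_of_tendsto_of_le_of_le ?_ ?_ hlow hup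
  · simpa using ENNReal.Tendsto.sub (tendsto_const_nhds (x := eLpNorm g q μ)) h
      (Or.inl hg.eLpNorm_ne_top)
  · simpa using (tendsto_const_nhds (x := eLpNorm g q μ)).add h

theorem eLpNorm_ofReal_rpow {p : ℝ} (hp : 0 < p) (f : X → F) :
    eLpNorm f (ENNReal.ofReal p) μ ^ p = ∫⁻ x, ‖f x‖ₑ ^ p ∂μ := by
  rw [eLpNorm_eq_lintegral_rpow_enorm_toReal (ENNReal.ofReal_pos.2 hp).ne' ENNReal.ofReal_ne_top,
    ENNReal.toReal_ofReal hp.le, ← ENNReal.rpow_mul, one_div_mul_cancel hp.ne', ENNReal.rpow_one]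

theorem integral_rpow_norm_eq_toReal {p : ℝ} (hp : 0 < p) {f : X → F}
    (hf : AEStronglyMeasurable f μ) :
    ∫ x, ‖f x‖ ^ p ∂μ = (eLpNorm f (ENNReal.ofReal p) μ ^ p).toReal := by
  rw [eLpNorm_ofReal_rpow hp, integral_eq_lintegral_of_nonneg_ae]
  · congr 1
    refine lintegral_congr fun x => ?_
    rw [← ofReal_norm, ENNReal.ofReal_rpow_of_nonneg (norm_nonneg _) hp.le]
  · exact Eventually.of_forall fun x => by positivity
  · exact (hf.norm.aemeasurable.pow_const p).aestronglyMeasurable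

end Lp

/-! ### From smooth functions to Sobolev functions and the eigenvalue -/

section Rayleigh

variable {n : ℕ} {p β : ℝ} {H : E n → ℝ} {Ω : Set (E n)}

/-- Surface measure weighted with `H(ν)`. -/
noncomputable def anisoSurfaceMeasure (H : E n → ℝ) (Ω : Set (E n)) : Measure (E n) :=
  (surfaceMeasure Ω).withDensity fun y => ENNReal.ofReal (H (outerNormal Ω y))

theorem aemeasurable_map_outerNormal (hH : IsAdmissibleNorm p H) (hΩ : IsOpen Ω)
    (hc : Convex ℝ Ω) (hN : ∀ x ∈ frontier Ω, ∃ v, IsOuterNormal Ω x v) :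
    AEMeasurable (fun y => H (outerNormal Ω y)) (surfaceMeasure Ω) :=
  (hH.continuous.comp_continuousOn (continuousOn_outerNormal hΩ hc hN)).aemeasurable
    isClosed_frontier.measurableSet

/-- Normals have unit length, so `H ν` is bounded; hence `L^p` convergence of traces for surface
measure passes to the weighted measure. -/
theorem exists_anisoSurfaceMeasure_le (hH : IsAdmissibleNorm p H)
    (hN : ∀ x ∈ frontier Ω, ∃ v, IsOuterNormal Ω x v) :
    ∃ b : ENNReal, b ≠ ⊤ ∧ anisoSurfaceMeasure H Ω ≤ b • surfaceMeasure Ω := by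
  obtain ⟨a, b, ha, hab, h⟩ := hH.comparable
  refine ⟨ENNReal.ofReal b, ENNReal.ofReal_ne_top, ?_⟩
  rw [← withDensity_const]
  refine withDensity_mono ?_
  refine (ae_restrict_iff' isClosed_frontier.measurableSet).2 (Eventually.of_forall fun y hy => ?_)
  apply ENNReal.ofReal_le_ofReal
  have := (h (outerNormal Ω y)).2
  rwa [(isOuterNormal_outerNormal (hN y hy)).1, mul_one] at this

theorem eLpNorm_anisoSurfaceMeasure_rpow (hp : 0 < p) (hH : IsAdmissibleNorm p H)
    (hΩ : IsOpen Ω) (hc : Convex ℝ Ω) (hN : ∀ x ∈ frontier Ω, ∃ v, IsOuterNormal Ω x v)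
    {g : E n → ℝ} (hg : AEStronglyMeasurable g (surfaceMeasure Ω)) :
    eLpNorm g (ENNReal.ofReal p) (anisoSurfaceMeasure H Ω) ^ p =
      ∫⁻ y, ENNReal.ofReal (H (outerNormal Ω y)) * ‖g y‖ₑ ^ p ∂(surfaceMeasure Ω) := by
  rw [eLpNorm_ofReal_rpow hp, anisoSurfaceMeasure, lintegral_withDensity_eq_lintegral_mul₀'
    (aemeasurable_map_outerNormal hH hΩ hc hN).ennreal_ofReal]
  · rfl
  · exact (hg.enorm.pow_const p).mono_ac (withDensity_absolutelyContinuous _ _)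

theorem integral_boundary_eq_toReal (hp : 0 < p) (hH : IsAdmissibleNorm p H)
    (hΩ : IsOpen Ω) (hc : Convex ℝ Ω) (hN : ∀ x ∈ frontier Ω, ∃ v, IsOuterNormal Ω x v)
    {g : E n → ℝ} (hg : AEStronglyMeasurable g (surfaceMeasure Ω)) :
    ∫ x, |g x| ^ p * H (outerNormal Ω x) ∂(surfaceMeasure Ω) =
      (eLpNorm g (ENNReal.ofReal p) (anisoSurfaceMeasure H Ω) ^ p).toReal := by
  rw [eLpNorm_anisoSurfaceMeasure_rpow hp hH hΩ hc hN hg, integral_eq_lintegral_of_nonneg_ae]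
  · congr 1
    refine lintegral_congr fun x => ?_
    rw [mul_comm, ENNReal.ofReal_mul (hH.nonneg _), Real.enorm_eq_ofReal_abs,
      ENNReal.ofReal_rpow_of_nonneg (abs_nonneg _) hp.le]
  · exact Eventually.of_forall fun x => mul_nonneg (by positivity) (hH.nonneg _)
  · exact ((hg.norm.aemeasurable.pow_const p).mul
      (aemeasurable_map_outerNormal hH hΩ hc hN)).aestronglyMeasurable

/-- The Robin-Poincaré inequality on `W^{1,p}`. -/
theorem le_rayleigh (hn : 0 < n) (hp : 1 < p) (hβ : 0 < β) (hH : IsAdmissibleNorm p H)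
    (hΩ : IsOpen Ω) (hne : Ω.Nonempty) (hc : Convex ℝ Ω) (hb : Bornology.IsBounded Ω)
    (hN : ∀ x ∈ frontier Ω, ∃ v, IsOuterNormal Ω x v) {u : E n → ℝ} {G : E n → E n}
    {g : E n → ℝ} (hu : MemW1p p Ω u G) (hg : IsTrace p Ω u G g)
    (hu0 : ¬ u =ᵐ[volume.restrict Ω] 0) :
    (lineConst p β (anisoInradius H Ω))⁻¹ ≤ rayleigh p β H Ω u G g := by
  have hp0 : 0 < p := by linarith
  have hq : 1 ≤ ENNReal.ofReal p := by rw [← ENNReal.ofReal_one]; exact ENNReal.ofReal_le_ofReal hp.le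
  set K := lineConst p β (anisoInradius H Ω)
  have hK : 0 < K := lineConst_pos hβ (anisoInradius_pos hn hH hΩ hne hb)
  obtain ⟨hgL, w, hw, hwu, hwG, hwg⟩ := hg
  obtain ⟨b, hbtop, hbσ⟩ := exists_anisoSurfaceMeasure_le hH hN
  obtain ⟨a₁, b₁, ha₁, hab₁, hcmp⟩ := hH.comparable
  set μ := anisoSurfaceMeasure H Ω
  have hac : μ ≪ surfaceMeasure Ω := withDensity_absolutelyContinuous _ _
  have hμle : ∀ f : E n → ℝ, eLpNorm f (ENNReal.ofReal p) μ ≤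
      b ^ (1 / p) * eLpNorm f (ENNReal.ofReal p) (surfaceMeasure Ω) := by
    intro f
    refine (eLpNorm_mono_measure f hbσ).trans_eq ?_
    rw [eLpNorm_smul_measure_of_ne_top ENNReal.ofReal_ne_top, ENNReal.toReal_div,
      ENNReal.toReal_one, ENNReal.toReal_ofReal hp0.le, smul_eq_mul]
  have hbp : b ^ (1 / p) ≠ ⊤ := ENNReal.rpow_ne_top_of_nonneg (by positivity) hbtop
  have hgμ : MemLp g (ENNReal.ofReal p) μ :=
    ⟨hgL.1.mono_ac hac, (hμle g).trans_lt (ENNReal.mul_lt_top hbp.lt_top hgL.2)⟩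
  have hHG : MemLp (fun x => H (G x)) (ENNReal.ofReal p) (volume.restrict Ω) := by
    refine hu.memLp_grad.of_le_mul (c := b₁)
      (hH.continuous.comp_aestronglyMeasurable hu.memLp_grad.1) (Eventually.of_forall fun x => ?_)
    rw [Real.norm_of_nonneg (hH.nonneg _)]
    exact (hcmp _).2
  have t1 := tendsto_eLpNorm_of_tendsto_sub hq
    (fun k => (hw k).continuous.aestronglyMeasurable) hu.memLp hwu
  have t2 : Tendsto (fun k => eLpNorm (w k) (ENNReal.ofReal p) μ) atTop
      (𝓝 (eLpNorm g (ENNReal.ofReal p) μ)) := by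
    refine tendsto_eLpNorm_of_tendsto_sub hq
      (fun k => (hw k).continuous.aestronglyMeasurable) hgμ ?_
    refine tendsto_of_tendsto_of_tendsto_of_le_of_le tendsto_const_nhds ?_ (fun _ => zero_le)
      (fun k => hμle _)
    simpa using ENNReal.Tendsto.const_mul hwg (Or.inr hbp)
  have t3 : Tendsto (fun k => eLpNorm (fun x => H (∇ (w k) x)) (ENNReal.ofReal p)
      (volume.restrict Ω)) atTop
      (𝓝 (eLpNorm (fun x => H (G x)) (ENNReal.ofReal p) (volume.restrict Ω))) := by
    refine tendsto_eLpNorm_of_tendsto_sub hq (fun k =>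
      (hH.continuous.comp (continuous_gradient (hw k))).aestronglyMeasurable) hHG ?_
    refine tendsto_of_tendsto_of_tendsto_of_le_of_le tendsto_const_nhds ?_ (fun _ => zero_le)
      (fun k => eLpNorm_le_mul_eLpNorm_of_ae_le_mul (c := b₁)
        (g := fun x => ∇ (w k) x - G x) (Eventually.of_forall fun x => ?_) _)
    · simpa using ENNReal.Tendsto.const_mul hwG (Or.inr ENNReal.ofReal_ne_top)
    · exact (hH.abs_sub_le _ _).trans (hcmp _).2
  set U := eLpNorm u (ENNReal.ofReal p) (volume.restrict Ω) ^ p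
  set B := eLpNorm g (ENNReal.ofReal p) μ ^ p
  set A := eLpNorm (fun x => H (G x)) (ENNReal.ofReal p) (volume.restrict Ω) ^ p
  -- All three terms converge along the smooth sequence that witnesses the trace, so the smooth
  -- inequality passes to the limit.
  have hineq : U ≤ ENNReal.ofReal K * (ENNReal.ofReal β * B + A) := by
    have hc1 := fun x => (ENNReal.continuous_rpow_const (y := p)).tendsto x
    refine le_of_tendsto_of_tendsto' ((hc1 _).comp t1)
      (ENNReal.Tendsto.const_mul ((ENNReal.Tendsto.const_mul ((hc1 _).comp t2)
        (Or.inr ENNReal.ofReal_ne_top)).add ((hc1 _).comp t3)) (Or.inr ENNReal.ofReal_ne_top))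
      fun k => ?_
    have h := smooth_estimate hn hp hβ hH hΩ hne hc hb hN (hw k)
    simp only [Function.comp_apply]
    rw [eLpNorm_ofReal_rpow hp0, eLpNorm_anisoSurfaceMeasure_rpow hp0 hH hΩ hc hN
      (hw k).continuous.aestronglyMeasurable, eLpNorm_ofReal_rpow hp0]
    refine h.trans_eq ?_
    congr 3
    ext x
    rw [Real.enorm_of_nonneg (hH.nonneg _)]
  have hBtop : B ≠ ⊤ := ENNReal.rpow_ne_top_of_nonneg hp0.le hgμ.eLpNorm_ne_top
  have hAtop : A ≠ ⊤ := ENNReal.rpow_ne_top_of_nonneg hp0.le hHG.eLpNorm_ne_top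
  have hUtop : U ≠ ⊤ := ENNReal.rpow_ne_top_of_nonneg hp0.le hu.memLp.eLpNorm_ne_top
  have hU0 : U ≠ 0 := by
    intro h
    rw [ENNReal.rpow_eq_zero_iff_of_pos hp0,
      eLpNorm_eq_zero_iff hu.memLp.1 (ENNReal.ofReal_pos.2 hp0).ne'] at h
    exact hu0 h
  have hreal : U.toReal ≤ K * (β * B.toReal + A.toReal) := by
    have hβB : ENNReal.ofReal β * B ≠ ⊤ := ENNReal.mul_ne_top ENNReal.ofReal_ne_top hBtop
    have := ENNReal.toReal_mono (ENNReal.mul_ne_top ENNReal.ofReal_ne_top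
      (ENNReal.add_ne_top.2 ⟨hβB, hAtop⟩)) hineq
    rwa [ENNReal.toReal_mul, ENNReal.toReal_ofReal hK.le, ENNReal.toReal_add hβB hAtop,
      ENNReal.toReal_mul, ENNReal.toReal_ofReal hβ.le] at this
  have e1 : ∫ x in Ω, |u x| ^ p = U.toReal := integral_rpow_norm_eq_toReal hp0 hu.memLp.1
  have e2 : ∫ x in Ω, H (G x) ^ p = A.toReal := by
    rw [← integral_rpow_norm_eq_toReal hp0 hHG.1]
    simp only [Real.norm_of_nonneg (hH.nonneg _)]
  have e3 := integral_boundary_eq_toReal hp0 hH hΩ hc hN hgL.1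
  rw [rayleigh, e1, e2, e3, le_div_iff₀ (ENNReal.toReal_pos hU0 hUtop), inv_mul_le_iff₀ hK]
  linarith

/-- The test function vanishes off `Ω`, so both integrals extend to the whole space, where
integration by parts in each fixed direction `v` has no boundary term. -/
theorem isWeakGradient_gradient {f : E n → ℝ} (hf : ContDiff ℝ ∞ f) (hfc : HasCompactSupport f) :
    IsWeakGradient Ω f (∇ f) := by
  intro ψ hψ hψc hψΩ
  have h0 : ∀ x, x ∉ Ω → ψ x = 0 ∧ ∇ ψ x = 0 := by
    intro x hx
    have hx' : x ∉ tsupport ψ := fun h => hx (hψΩ h)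
    refine ⟨image_eq_zero_of_notMem_tsupport hx', ?_⟩
    rw [gradient, fderiv_of_notMem_tsupport ℝ hx', map_zero]
  rw [setIntegral_eq_integral_of_forall_compl_eq_zero fun x hx => by rw [(h0 x hx).2, smul_zero],
    setIntegral_eq_integral_of_forall_compl_eq_zero fun x hx => by rw [(h0 x hx).1, zero_smul]]
  have hdf := hf.differentiable (by simp)
  have hdψ := hψ.differentiable (by simp)
  have i1 : Integrable (fun x => f x • ∇ ψ x) :=
    (hf.continuous.smul (continuous_gradient hψ)).integrable_of_hasCompactSupport hfc.smul_right
  have i2 : Integrable (fun x => ψ x • ∇ f x) :=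
    (hψ.continuous.smul (continuous_gradient hf)).integrable_of_hasCompactSupport hψc.smul_right
  refine ext_inner_left ℝ fun v => ?_
  rw [inner_neg_right, ← integral_inner i1, ← integral_inner i2]
  have hfd : ∀ {g : E n → ℝ}, Differentiable ℝ g → ∀ x, fderiv ℝ g x v = ⟪v, ∇ g x⟫ := by
    intro g hg x
    rw [(hg x).hasGradientAt.hasFDerivAt.fderiv, InnerProductSpace.toDual_apply_apply, real_inner_comm]
  have h := integral_mul_fderiv_eq_neg_fderiv_mul_of_integrable (μ := (volume : Measure (E n)))
    (f := f) (g := ψ) (v := v) ?_ ?_ ?_ (fun x _ => hdf x) (fun x _ => hdψ x)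
  · simpa only [hfd hdf, hfd hdψ, inner_smul_right, mul_comm] using h
  · simpa only [hfd hdf, inner_smul_right, mul_comm] using i2.const_inner (𝕜 := ℝ) v
  · simpa only [hfd hdψ, inner_smul_right] using i1.const_inner (𝕜 := ℝ) v
  · exact (hf.continuous.mul hψ.continuous).integrable_of_hasCompactSupport hfc.mul_right

/-- There is an admissible test function. -/
theorem exists_test_function (hΩ : IsOpen Ω) (hne : Ω.Nonempty) :
    ∃ (u : E n → ℝ) (G : E n → E n) (g : E n → ℝ), MemW1p p Ω u G ∧ IsTrace p Ω u G g ∧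
      ¬ (u =ᵐ[volume.restrict Ω] 0) := by
  obtain ⟨x₀, hx₀⟩ := hne
  obtain ⟨r, hr, hball⟩ := Metric.isOpen_iff.1 hΩ x₀ hx₀
  let f : ContDiffBump x₀ := ⟨r / 3, r / 2, by positivity, by linarith⟩
  have hsub : Metric.ball x₀ (r / 3) ⊆ Ω := (Metric.ball_subset_ball (by linarith)).trans hball
  have hf : ContDiff ℝ ∞ f := f.contDiff
  have hfc : HasCompactSupport f := f.hasCompactSupport
  have hgc : HasCompactSupport (∇ (f : E n → ℝ)) := by
    refine hfc.mono' fun x hx => ?_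
    by_contra hx'
    exact hx (by rw [gradient, fderiv_of_notMem_tsupport ℝ hx', map_zero])
  refine ⟨f, ∇ f, 0, ⟨hf.continuous.memLp_of_hasCompactSupport hfc,
    (continuous_gradient hf).memLp_of_hasCompactSupport hgc, isWeakGradient_gradient hf hfc⟩,
    ⟨MemLp.zero, fun _ => f, fun _ => hf, ?_, ?_, ?_⟩, ?_⟩
  · simp
  · simp
  -- The bump vanishes at distance `r / 2` or more from `x₀`, and the frontier is at distance at
  -- least `r`.
  · have : (fun x => f x - (0 : E n → ℝ) x) =ᵐ[surfaceMeasure Ω] 0 := by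
      refine (ae_restrict_iff' isClosed_frontier.measurableSet).2
        (Eventually.of_forall fun x hx => ?_)
      simp only [Pi.zero_apply, sub_zero]
      apply f.zero_of_le_dist
      by_contra! hlt
      rw [hΩ.frontier_eq] at hx
      exact hx.2 (hball (hlt.trans (by change r / 2 < r; linarith)))
    simp only [eLpNorm_congr_ae this, eLpNorm_zero]
    exact tendsto_const_nhds
  · intro h
    have h1 := (ae_restrict_iff' hΩ.measurableSet).1 h
    have h2 : volume (Metric.ball x₀ (r / 3)) = 0 := by
      refine measure_mono_null (fun x hx => ?_) h1
      intro h3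
      have h4 : f x = 1 := f.one_of_mem_closedBall (Metric.ball_subset_closedBall hx)
      have h5 : f x = 0 := h3 (hsub hx)
      rw [h4] at h5
      exact one_ne_zero h5
    exact (Metric.measure_ball_pos volume x₀ (by positivity)).ne' h2

/-- The lower bound on the first eigenvalue. -/
theorem inv_lineConst_le_firstEigenvalue (hn : 0 < n) (hp : 1 < p) (hβ : 0 < β)
    (hH : IsAdmissibleNorm p H) (hΩ : IsOpen Ω) (hne : Ω.Nonempty) (hc : Convex ℝ Ω)
    (hb : Bornology.IsBounded Ω) (hC : HasC2Boundary Ω) :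
    (lineConst p β (anisoInradius H Ω))⁻¹ ≤ firstEigenvalue p β H Ω := by
  -- The real `sInf ∅` is `0`, so a positive lower bound needs at least one competitor.
  obtain ⟨u, G, g, hu, hg, h0⟩ := exists_test_function (p := p) hΩ hne
  refine le_csInf ⟨_, u, G, g, hu, hg, h0, rfl⟩ ?_
  rintro _ ⟨u, G, g, hu, hg, h0, rfl⟩
  exact le_rayleigh hn hp hβ hH hΩ hne hc hb (hC.exists_isOuterNormal hΩ) hu hg h0

end Rayleigh

/-! ### Thin ellipsoids of prescribed volume -/

section Ellipsoid

variable {n : ℕ} {p β : ℝ} {H : E n → ℝ} {Ω : Set (E n)}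

/-- A `C²` graph function is only locally Lipschitz, so the neighbourhood is shrunk until it is
Lipschitz there, and that restriction is extended to the whole hyperplane. -/
theorem HasC2Boundary.hasLipschitzBoundary (h : HasC2Boundary Ω) : HasLipschitzBoundary Ω := by
  intro x hx
  obtain ⟨U, hU, e, he, φ, hφ, hsub⟩ := h x hx
  set P := (ℝ ∙ e)ᗮ.orthogonalProjectionOnto
  obtain ⟨K, t, ht, hK⟩ := (hφ.of_le (by norm_num : (1 : WithTop ℕ∞) ≤ 2)).contDiffAt.exists_lipschitzOnWith
    (x := P x)
  obtain ⟨ψ, hψ, heq⟩ := hK.extend_real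
  refine ⟨U ∩ P ⁻¹' t, inter_mem hU (P.continuous.continuousAt.preimage_mem_nhds ht), e, he, ψ,
    ⟨K, hψ⟩, ?_⟩
  rw [IsSubgraphIn, ← inter_assoc, hsub]
  ext y
  constructor
  · rintro ⟨⟨h1, h2⟩, h3⟩
    exact ⟨⟨h1, h3⟩, (heq h3) ▸ h2⟩
  · rintro ⟨⟨h1, h3⟩, h2⟩
    refine ⟨⟨h1, ?_⟩, h3⟩
    rw [heq h3]
    exact h2

/-- A smooth function on the line that agrees with the square root near a positive number. -/
theorem contDiff_bump_mul_sqrt {c : ℝ} (χ : ContDiffBump c) (hχ : χ.rOut < c) :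
    ContDiff ℝ 2 fun s => χ s * √s := by
  refine contDiff_iff_contDiffAt.2 fun s => ?_
  rcases eq_or_ne s 0 with rfl | hs
  · have h0 : (fun s => χ s * √s) =ᶠ[𝓝 0] fun _ => 0 := by
      have hev : ∀ᶠ s : ℝ in 𝓝 0, χ.rOut < dist s c := by
        refine (by fun_prop : Continuous fun s : ℝ => dist s c).continuousAt.eventually_const_lt ?_
        change χ.rOut < dist 0 c
        rwa [Real.dist_eq, zero_sub, abs_neg, abs_of_pos (χ.rOut_pos.trans hχ)]
      filter_upwards [hev] with s hs
      rw [χ.zero_of_le_dist hs.le, zero_mul]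
    exact contDiffAt_const.congr_of_eventuallyEq h0
  · exact χ.contDiffAt.mul (Real.contDiffAt_sqrt hs)

theorem hasC2Boundary_ellipsoid (A : E n ≃L[ℝ] E n) {r : ℝ} (hr : 0 < r) :
    HasC2Boundary (A ⁻¹' Metric.ball 0 r) := by
  intro x hx
  have hnorm : ‖A x‖ = r := by
    have h1 : x ∈ A ⁻¹' frontier (Metric.ball 0 r) :=
      A.continuous.frontier_preimage_subset _ hx
    simpa [frontier_ball (0 : E n) hr.ne'] using h1
  have hx0 : x ≠ 0 := by rintro rfl; simp at hnorm; exact hr.ne hnorm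
  have hxn := norm_pos_iff.2 hx0
  set e := ‖x‖⁻¹ • x
  have hxe : x = ‖x‖ • e := (smul_inv_smul₀ hxn.ne' x).symm
  have he : ‖e‖ = 1 := by rw [norm_smul, norm_inv, norm_norm, inv_mul_cancel₀ hxn.ne']
  have he0 : e ≠ 0 := norm_ne_zero_iff.1 (by rw [he]; exact one_ne_zero)
  set P := (ℝ ∙ e)ᗮ.orthogonalProjectionOnto
  set α := ‖A e‖ ^ 2
  have hα : 0 < α := pow_pos (norm_pos_iff.2 ((map_ne_zero_iff A A.injective).2 he0)) 2
  set b : (ℝ ∙ e)ᗮ → ℝ := fun z => ⟪A z, A e⟫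
  -- Completing the square, `‖A (z + s • e)‖ < r` means `(α * s + b z) ^ 2 < D z`. Where `α * s + b
  -- z > 0`, this says that `s` lies below the upper root `(√(D z) - b z) / α`.
  set D : (ℝ ∙ e)ᗮ → ℝ := fun z => b z ^ 2 - α * (‖A z‖ ^ 2 - r ^ 2)
  have hAz : ContDiff ℝ 2 fun z : (ℝ ∙ e)ᗮ => A (z : E n) :=
    A.contDiff.comp (ℝ ∙ e)ᗮ.subtypeL.contDiff
  have hb : ContDiff ℝ 2 b := hAz.inner ℝ contDiff_const
  have hD : ContDiff ℝ 2 D :=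
    (hb.pow 2).sub (contDiff_const.mul ((hAz.norm_sq ℝ).sub contDiff_const))
  have hc : 0 < α * r ^ 2 := by positivity
  -- The square root is not smooth at zero. The cutoff equals `1` near the value `D 0 = α * r ^ 2`
  -- and vanishes near zero, which makes the graph function globally `C²`.
  let χ : ContDiffBump (α * r ^ 2) :=
    ⟨α * r ^ 2 / 4, α * r ^ 2 / 2, by positivity, by linarith⟩
  have hPx : P x = 0 := by
    rw [hxe, map_smul, Submodule.orthogonalProjectionOnto_orthogonal_apply_eq_zero
      (Submodule.mem_span_singleton_self e), smul_zero]
  have hPc : Continuous P := P.continuous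
  have hcont1 : Continuous fun y => dist (D (P y)) (α * r ^ 2) :=
    (hD.continuous.comp hPc).dist continuous_const
  have hcont2 : Continuous fun y => α * ⟪e, y⟫ + b (P y) := by
    have := hb.continuous.comp hPc
    fun_prop
  refine ⟨{y | dist (D (P y)) (α * r ^ 2) < α * r ^ 2 / 4 ∧ 0 < α * ⟪e, y⟫ + b (P y)}, ?_, e, he,
    fun z => (χ (D z) * √(D z) - b z) / α,
    (((contDiff_bump_mul_sqrt χ (by change α * r ^ 2 / 2 < _; linarith)).comp hD).sub
      hb).div_const _, ?_⟩
  · refine ((isOpen_lt hcont1 continuous_const).inter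
      (isOpen_lt continuous_const hcont2)).mem_nhds ⟨?_, ?_⟩
    · change dist (D (P x)) (α * r ^ 2) < α * r ^ 2 / 4
      rw [hPx]
      simpa [D, b] using hc
    · change 0 < α * ⟪e, x⟫ + b (P x)
      rw [hPx]
      have : ⟪e, x⟫ = ‖x‖ := by
        conv_lhs => rw [hxe]
        rw [inner_smul_right, real_inner_self_eq_norm_sq, he]; ring
      rw [this]
      simp only [b, ZeroMemClass.coe_zero, map_zero, inner_zero_left]
      positivity
  · ext y
    rw [mem_inter_iff, and_comm]
    refine and_congr_right fun ⟨hy1, hy2⟩ => ?_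
    have hχ : χ (D (P y)) = 1 := χ.one_of_mem_closedBall (le_of_lt hy1)
    have hdec : A y = A (P y : E n) + ⟪e, y⟫ • A e := by
      rw [← map_smul, ← map_add, inner_projection_add y he]
    have hquad : α * (‖A y‖ ^ 2 - r ^ 2) = (α * ⟪e, y⟫ + b (P y)) ^ 2 - D (P y) := by
      rw [hdec, @norm_add_sq_real, norm_smul, inner_smul_right, mul_pow, Real.norm_eq_abs,
        sq_abs]
      simp only [D, b, α]
      ring
    have hmem : y ∈ A ⁻¹' Metric.ball 0 r ↔ ‖A y‖ ^ 2 - r ^ 2 < 0 := by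
      rw [mem_preimage, mem_ball_zero_iff, sub_neg, sq_lt_sq₀ (norm_nonneg _) hr.le]
    rw [hmem]
    change _ ↔ ⟪e, y⟫ < (χ (D (P y)) * √(D (P y)) - b (P y)) / α
    rw [hχ, one_mul, lt_div_iff₀ hα, lt_sub_iff_add_lt, mul_comm _ α, Real.lt_sqrt hy2.le,
      ← sub_neg (b := D (P y)), ← hquad]
    constructor
    · exact fun h => mul_neg_of_pos_of_neg hα h
    · exact fun h => (pos_iff_neg_of_mul_neg h).1 hα

/-- A volume-preserving map that stretches one direction by the factor `s`. -/
theorem exists_stretch (hn : 2 ≤ n) {s : ℝ} (hs : 0 < s) :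
    ∃ (e : E n) (A : E n ≃L[ℝ] E n), ‖e‖ = 1 ∧ (∀ x, ⟪e, A x⟫ = s * ⟪e, x⟫) ∧
      ∀ S : Set (E n), volume (A ⁻¹' S) = volume S := by
  set e₀ : E n := EuclideanSpace.single ⟨0, by omega⟩ 1
  set e₁ : E n := EuclideanSpace.single ⟨1, by omega⟩ 1
  have h0 : ⟪e₀, e₀⟫ = 1 := by simp [e₀]
  have h1 : ⟪e₁, e₁⟫ = 1 := by simp [e₁]
  have h01 : ⟪e₀, e₁⟫ = 0 := by
    rw [EuclideanSpace.inner_single_left, PiLp.single_apply,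
      if_neg (by simp), mul_zero]
  -- `T₀` multiplies the `e₀` coordinate by `s`, and `T₁` multiplies the `e₁` coordinate by `s⁻¹` to
  -- keep the determinant equal to `1`; this takes two dimensions.
  set T₀ := LinearMap.transvection ((s - 1) • innerₛₗ ℝ e₀ : E n →ₗ[ℝ] ℝ) e₀
  set T₁ := LinearMap.transvection ((s⁻¹ - 1) • innerₛₗ ℝ e₁ : E n →ₗ[ℝ] ℝ) e₁
  have hdet : LinearMap.det (T₀ ∘ₗ T₁) = 1 := by
    rw [LinearMap.det_comp, LinearMap.transvection.det, LinearMap.transvection.det]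
    simp only [LinearMap.smul_apply, innerₛₗ_apply_apply, h0, h1, smul_eq_mul]
    field_simp
    ring
  have hdet0 : LinearMap.det (T₀ ∘ₗ T₁) ≠ 0 := by rw [hdet]; exact one_ne_zero
  refine ⟨e₀, (LinearMap.equivOfDetNeZero _ hdet0).toContinuousLinearEquiv, by simp [e₀],
    fun x => ?_, fun S => ?_⟩
  · change ⟪e₀, T₀ (T₁ x)⟫ = s * ⟪e₀, x⟫
    simp only [T₀, T₁, LinearMap.transvection.apply, LinearMap.smul_apply, innerₛₗ_apply_apply,
      inner_add_right, inner_smul_right, smul_eq_mul, h0, h01]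
    ring
  · change volume ((T₀ ∘ₗ T₁) ⁻¹' S) = volume S
    rw [Measure.addHaar_preimage_linearMap _ hdet0, hdet]
    simp

theorem exists_mem_frontier_of_isPreconnected {X : Type*} [TopologicalSpace X] {s t : Set X}
    (hs : IsOpen s) (ht : IsPreconnected t) (h1 : (t ∩ s).Nonempty) (h2 : (t ∩ sᶜ).Nonempty) :
    (t ∩ frontier s).Nonempty := by
  by_contra hempty
  have hcl : ∀ x ∈ t, x ∉ s → x ∈ (closure s)ᶜ := fun x hx hxs hxc =>
    hempty ⟨x, hx, by rw [hs.frontier_eq]; exact ⟨hxc, hxs⟩⟩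
  obtain ⟨y, hy, hys⟩ := h2
  obtain ⟨z, -, hz, hzc⟩ := ht s (closure s)ᶜ hs isClosed_closure.isOpen_compl
    (fun x hx => (em (x ∈ s)).imp id (hcl x hx)) h1 ⟨y, hy, hcl y hy hys⟩
  exact hzc (subset_closure hz)

/-- The ellipsoid lies in the slab `|⟪e, x⟫| < r / s`, so from any of its points a step of length `r
/ s` along `e`, away from the middle hyperplane, leaves it and crosses the frontier. -/
theorem anisoInradius_ellipsoid_le (hn : 0 < n) (hH : IsAdmissibleNorm p H) {b : ℝ} (hb : 0 < b)
    (hpolar : ∀ v : E n, polar H v ≤ b * ‖v‖)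
    {A : E n ≃L[ℝ] E n} {e : E n} (he : ‖e‖ = 1) {r s : ℝ} (hr : 0 < r) (hs : 0 < s)
    (hA : ∀ x, ⟪e, A x⟫ = s * ⟪e, x⟫) :
    anisoInradius H (A ⁻¹' Metric.ball 0 r) ≤ b * (r / s) := by
  have : Nonempty (A ⁻¹' Metric.ball 0 r : Set (E n)) := ⟨⟨0, by simpa using hr⟩⟩
  refine ciSup_le fun ⟨x, hx⟩ => ?_
  obtain ⟨t, ht, hout⟩ : ∃ t : ℝ, |t| = r / s ∧ x + t • e ∉ A ⁻¹' Metric.ball 0 r := by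
    have hkey : ∀ t : ℝ, r / s ≤ |⟪e, x⟫ + t| → x + t • e ∉ A ⁻¹' Metric.ball 0 r := by
      intro t ht hmem
      rw [mem_preimage, mem_ball_zero_iff] at hmem
      have h1 := abs_real_inner_le_norm e (A (x + t • e))
      rw [hA, he, one_mul, inner_add_right, inner_smul_right, real_inner_self_eq_norm_sq, he,
        abs_mul, abs_of_pos hs, one_pow, mul_one] at h1
      rw [div_le_iff₀ hs] at ht
      linarith
    rcases le_total 0 ⟪e, x⟫ with h | h
    · exact ⟨r / s, abs_of_pos (by positivity), hkey _ ((le_add_of_nonneg_left h).trans (le_abs_self _))⟩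
    · refine ⟨-(r / s), by rw [abs_neg, abs_of_pos (by positivity)], hkey _ ?_⟩
      rw [abs_of_nonpos (by linarith [div_pos hr hs])]
      linarith
  obtain ⟨y, hy, hyf⟩ := exists_mem_frontier_of_isPreconnected
    (Metric.isOpen_ball.preimage A.continuous) (convex_segment x (x + t • e)).isPreconnected
    ⟨x, left_mem_segment ℝ _ _, hx⟩ ⟨_, right_mem_segment ℝ _ _, hout⟩
  refine (ciInf_le (bddBelow_polar_frontier hn hH x) ⟨y, hyf⟩).trans ?_
  refine (hpolar _).trans ?_
  gcongr
  rw [segment_eq_image'] at hy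
  obtain ⟨θ, ⟨hθ0, hθ1⟩, rfl⟩ := hy
  have : x - (x + θ • (x + t • e - x)) = -(θ * t) • e := by module
  change ‖x - (x + θ • (x + t • e - x))‖ ≤ r / s
  rw [this, norm_smul, he, mul_one, norm_neg, norm_mul, Real.norm_of_nonneg hθ0,
    Real.norm_eq_abs, ht]
  exact mul_le_of_le_one_left (by positivity) hθ1

theorem exists_ball_volume (hn : 0 < n) {m : ℝ} (hm : 0 < m) :
    ∃ r : ℝ, 0 < r ∧ volume (Metric.ball (0 : E n) r) = ENNReal.ofReal m := by
  have : Nonempty (Fin n) := ⟨⟨0, hn⟩⟩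
  set V := (volume (Metric.ball (0 : E n) 1)).toReal
  have hV : 0 < V := ENNReal.toReal_pos (Metric.measure_ball_pos _ _ one_pos).ne'
    measure_ball_lt_top.ne
  refine ⟨(m / V) ^ (1 / (n : ℝ)), by positivity, ?_⟩
  rw [Measure.addHaar_ball _ _ (by positivity), finrank_euclideanSpace_fin,
    ← ENNReal.ofReal_toReal (measure_ball_lt_top (x := (0 : E n)) (r := 1)).ne,
    ← ENNReal.ofReal_mul (by positivity), ← Real.rpow_natCast, ← Real.rpow_mul (by positivity),
    one_div_mul_cancel (by positivity), Real.rpow_one]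
  congr 1
  exact div_mul_cancel₀ _ hV.ne'

theorem lineConst_mono (hp : 1 < p) (hβ : 0 < β) {R R' : ℝ} (hR : 0 ≤ R) (h : R ≤ R') :
    lineConst p β R ≤ lineConst p β R' := by
  have : 0 ≤ p - 1 := by linarith
  have : 0 ≤ R' := hR.trans h
  unfold lineConst
  gcongr

theorem exists_lt_inv_lineConst (hβ : 0 < β) (M : ℝ) :
    ∃ ρ : ℝ, 0 < ρ ∧ M < (lineConst p β ρ)⁻¹ := by
  have hcont : ContinuousAt (lineConst p β) 0 := by
    unfold lineConst
    refine (continuousAt_id.mul (ContinuousAt.rpow_const (by fun_prop) (Or.inl ?_))).div_const _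
    simp
  have h0 : Tendsto (lineConst p β) (𝓝[>] 0) (𝓝[>] 0) := by
    refine tendsto_nhdsWithin_iff.2 ⟨?_, ?_⟩
    · have h := hcont.tendsto
      rw [show lineConst p β 0 = 0 by simp [lineConst]] at h
      exact h.mono_left nhdsWithin_le_nhds
    · filter_upwards [self_mem_nhdsWithin] with ρ hρ using lineConst_pos hβ hρ
  obtain ⟨ρ, h1, h2⟩ := (((tendsto_inv_nhdsGT_zero.comp h0).eventually_gt_atTop M).and
    self_mem_nhdsWithin).exists
  exact ⟨ρ, h2, h1⟩

/-- There are domains of given volume with arbitrarily large first eigenvalue. -/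
theorem exists_lt_firstEigenvalue (hn : 2 ≤ n) (hp : 1 < p) (hβ : 0 < β)
    (hH : IsAdmissibleNorm p H) {m : ℝ} (hm : 0 < m) (M : ℝ) :
    ∃ Ω : Set (E n), IsLipschitzDomain Ω ∧ volume Ω = ENNReal.ofReal m ∧
      M < firstEigenvalue p β H Ω := by
  have hn0 : 0 < n := by omega
  obtain ⟨a, b, ha, hb, hab⟩ := hH.exists_polar_bounds hn0
  obtain ⟨r, hr, hvol⟩ := exists_ball_volume hn0 hm
  obtain ⟨ρ, hρ, hM⟩ := exists_lt_inv_lineConst (p := p) hβ M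
  -- With this stretching factor the inradius bound `b * (r / s)` is exactly `ρ`.
  have hs : 0 < b * r / ρ := by positivity
  obtain ⟨e, A, he, hA, hAvol⟩ := exists_stretch hn hs
  set Ω : Set (E n) := A ⁻¹' Metric.ball 0 r
  have hΩ : IsOpen Ω := Metric.isOpen_ball.preimage A.continuous
  have hne : Ω.Nonempty := ⟨0, by simpa [Ω] using hr⟩
  have hc : Convex ℝ Ω := (convex_ball (0 : E n) r).linear_preimage (A : E n →ₗ[ℝ] E n)
  have hbd : Bornology.IsBounded Ω := A.antilipschitz.isBounded_preimage Metric.isBounded_ball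
  have hC : HasC2Boundary Ω := hasC2Boundary_ellipsoid A hr
  refine ⟨Ω, ⟨hΩ, ⟨hne, hc.isPreconnected⟩, hbd, hC.hasLipschitzBoundary⟩, ?_, ?_⟩
  · rw [hAvol, hvol]
  · have hle : anisoInradius H Ω ≤ ρ := by
      refine (anisoInradius_ellipsoid_le hn0 hH hb (fun v => (hab v).2) he hr hs hA).trans_eq ?_
      field_simp
    have hpos := anisoInradius_pos hn0 hH hΩ hne hbd
    calc M < (lineConst p β ρ)⁻¹ := hM
      _ ≤ (lineConst p β (anisoInradius H Ω))⁻¹ :=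
        inv_anti₀ (lineConst_pos hβ hpos) (lineConst_mono hp hβ hpos.le hle)
      _ ≤ _ := inv_lineConst_le_firstEigenvalue hn0 hp hβ hH hΩ hne hc hbd hC

end Ellipsoid

end AnisotropicRobin

theorem mainTheorem6 (n : ℕ) (hn : 2 ≤ n) (p β : ℝ) (hp : 1 < p) (hβ : 0 < β)
    (H : AnisotropicRobin.E n → ℝ) (hH : AnisotropicRobin.IsAdmissibleNorm p H)
    (hW : AnisotropicRobin.WulffPositivelyCurved H) :
    (∀ Ω : Set (AnisotropicRobin.E n), IsOpen Ω → Ω.Nonempty → Bornology.IsBounded Ω →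
      Convex ℝ Ω → AnisotropicRobin.HasC2Boundary Ω →
      ((p - 1) / p) ^ p *
          (β / (AnisotropicRobin.anisoInradius H Ω *
            (1 + β ^ (1 / (p - 1)) * AnisotropicRobin.anisoInradius H Ω) ^ (p - 1))) ≤
        AnisotropicRobin.firstEigenvalue p β H Ω) ∧
    (∀ m : ℝ, 0 < m →
      sSup {l : EReal | ∃ Ω : Set (AnisotropicRobin.E n), AnisotropicRobin.IsLipschitzDomain Ω ∧
        volume Ω = ENNReal.ofReal m ∧
        l = ((AnisotropicRobin.firstEigenvalue p β H Ω : ℝ) : EReal)} = ⊤) := by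
  have hn0 : 0 < n := by omega
  refine ⟨fun Ω hΩ hne hb hc hC => ?_, fun m hm => ?_⟩
  · have hR := AnisotropicRobin.anisoInradius_pos hn0 hH hΩ hne hb
    refine le_trans ?_
      (AnisotropicRobin.inv_lineConst_le_firstEigenvalue hn0 hp hβ hH hΩ hne hc hb hC)
    -- The bound already proved is the stated one without the factor `((p - 1) / p) ^ p`, which is
    -- at most `1`.
    rw [AnisotropicRobin.lineConst, inv_div]
    refine mul_le_of_le_one_left (by positivity) (Real.rpow_le_one ?_ ?_ (by linarith))
    · exact div_nonneg (by linarith) (by linarith)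
    · rw [div_le_one (by linarith)]; linarith
  · refine sSup_eq_top.2 fun l hl => ?_
    obtain ⟨M, hlM, -⟩ := EReal.lt_iff_exists_real_btwn.1 hl
    obtain ⟨Ω, hΩ, hvol, hM⟩ := AnisotropicRobin.exists_lt_firstEigenvalue hn hp hβ hH hm M
    exact ⟨_, ⟨Ω, hΩ, hvol, rfl⟩, hlM.trans (EReal.coe_lt_coe_iff.2 hM)⟩
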